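/- Fix an integer $n\ge 2$ and let $\mathbb T^n=(\mathbb R/\mathbb Z)^n$ carry its Lebesgue probability measure $\mu$. For a prime $p$, an integer $m\ge 0$ and a system $G=(G_1,\dots,G_n)$ of polynomials in $\mathbb F_p[X_1,\dots,X_m]$, let $\mu_G$ be the probability measure on $\mathbb T^n$ given by $$\mu_G(B)=p^{-m}\,\#\Big\{x\in\mathbb F_p^m:\Big(\frac{G_1(x)}p,\dots,\frac{G_n(x)}p\Big)\in B\Big\},$$ and for $v\in\mathbb Z^n$ let $$S_G(v)=\sum_{x\in\mathbb F_p^m}\exp\Big(\frac{2\pi i}{p}\sum_{j=1}^n v_jG_j(x)\Big).$$ For real $\eta\ge 0$ and $C$, say that $G$ is of type $\eta$ with constant $C$ if for all $v\in\mathbb Z^n$ one has $|S_G(v)|/p^m\le C$ if $v\in p\mathbb Z^n$, and $|S_G(v)|/p^m\le C\,p^{-\eta}$ otherwise. For $y\in\mathbb T^n$ and $R>0$ let $B_R(y)\subset\mathbb T^n$ be the closed ball of radius $R$ about $y$ for the Euclidean (flat geodesic) distance on $\mathbb T^n$, and define the ball discrepancy $$D(\mu_G)=\sup_{y\in\mathbb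 T^n,\;0<R<1/2}\big|\mu_G(B_R(y))-\mu(B_R(y))\big|.$$ Then for all real $\eta\ge 0$ and $C$ there is a constant $C'>0$, depending only on $n$, $\eta$ and $C$, such that for every prime $p$, every $m\ge 0$ and every system $G$ of $n$ polynomials in $m$ variables over $\mathbb F_p$ that is of type $\eta$ with constant $C$, $$D(\mu_G)\le C'\,p^{-2\min(\eta,n)/(n+1)}.$$ In particular, if $G=G^{(p)}$ runs through systems of type $\eta$ with a constant $C$ that does not depend on $p$, then $D(\mu_G)\ll p^{-2\min(\eta,n)/(n+1)}$ as $p\to\infty$. -/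

import Mathlib

open MeasureTheory
open scoped ENNReal

noncomputable section

/-- A system `(G_1, …, G_n)` of `n` polynomials in `m` variables over `𝔽_p`. -/
abbrev PolynomialSystem (p m n : ℕ) : Type := Fin n → MvPolynomial (Fin m) (ZMod p)

namespace PolynomialSystem

variable {p m n : ℕ} [Fact p.Prime]

/-- The point `(G_1(x)/p, …, G_n(x)/p)` of the torus `𝕋ⁿ = (ℝ/ℤ)ⁿ`, for `x ∈ 𝔽_p^m`;
`ZMod.toAddCircle` sends the class of an integer `k` to `k/p` modulo `1`. -/
def point (G : PolynomialSystem p m n) (x : Fin m → ZMod p) : UnitAddTorus (Fin n) :=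
  fun j => ZMod.toAddCircle (MvPolynomial.eval x (G j))

/-- The measure `μ_G` on `𝕋ⁿ`: every point of the multiset `A_G = {G(x)/p : x ∈ 𝔽_p^m}`
(counted with multiplicity) has mass `p^{-m}`. -/
def measure (G : PolynomialSystem p m n) : Measure (UnitAddTorus (Fin n)) :=
  ((p : ℝ≥0∞) ^ m)⁻¹ • ∑ x : Fin m → ZMod p, Measure.dirac (G.point x)

/-- The Weyl sum `S_G(v) = ∑_{x ∈ 𝔽_p^m} e_p(v · G(x))`; `ZMod.stdAddChar` sends the class of
an integer `k` to `e_p(k) = exp (2 π i k / p)`. -/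
def weylSum (G : PolynomialSystem p m n) (v : Fin n → ℤ) : ℂ :=
  ∑ x : Fin m → ZMod p,
    ZMod.stdAddChar (∑ j : Fin n, (v j : ZMod p) * MvPolynomial.eval x (G j))

open Classical in
/-- `G` is of type `η` with implied constant `C`: for all `v ∈ ℤⁿ` one has
`|S_G(v)| / p^m ≤ C` if `v ∈ p ℤⁿ`, and `|S_G(v)| / p^m ≤ C p^{-η}` otherwise. -/
def IsOfTypeWith (G : PolynomialSystem p m n) (η C : ℝ) : Prop :=
  ∀ v : Fin n → ℤ,
    ‖G.weylSum v‖ / (p : ℝ) ^ m ≤ C * (if ∀ j, (p : ℤ) ∣ v j then 1 else (p : ℝ) ^ (-η))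

end PolynomialSystem

/-- The closed ball of radius `R` about `y` for the Euclidean (flat geodesic) distance of `𝕋ⁿ`.
The norm of an element of `ℝ/ℤ` is its distance to `0`. -/
def torusBall {n : ℕ} (y : UnitAddTorus (Fin n)) (R : ℝ) : Set (UnitAddTorus (Fin n)) :=
  {x | √(∑ j : Fin n, ‖x j - y j‖ ^ 2) ≤ R}

/-- The ball discrepancy of a measure `ν` on `𝕋ⁿ`: the supremum of `|ν(B_R(y)) - μ(B_R(y))|` over
all centres `y ∈ 𝕋ⁿ` and all radii `0 < R < 1/2`, where `μ` is the Lebesgue measure of `𝕋ⁿ`. -/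
def ballDiscrepancy {n : ℕ} (ν : Measure (UnitAddTorus (Fin n))) : ℝ :=
  ⨆ q : UnitAddTorus (Fin n) × Set.Ioo (0 : ℝ) (1 / 2),
    |ν.real (torusBall q.1 q.2) - volume.real (torusBall q.1 q.2)|

/-- The measure `μ_G` is a probability measure. -/
instance PolynomialSystem.isProbabilityMeasure_measure {p m n : ℕ} [Fact p.Prime]
    (G : PolynomialSystem p m n) : IsProbabilityMeasure G.measure := by
  refine ⟨?_⟩
  have hp : (p : ℝ≥0∞) ≠ 0 := by exact_mod_cast (Fact.out : p.Prime).ne_zero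
  simp [PolynomialSystem.measure]
  exact ENNReal.inv_mul_cancel (pow_ne_zero _ hp) (by finiteness)

/-- The set whose supremum is the ball discrepancy of a probability measure is bounded above. -/
theorem bddAbove_ballDiscrepancy {n : ℕ} (ν : Measure (UnitAddTorus (Fin n)))
    [IsProbabilityMeasure ν] :
    BddAbove (Set.range fun q : UnitAddTorus (Fin n) × Set.Ioo (0 : ℝ) (1 / 2) =>
      |ν.real (torusBall q.1 q.2) - volume.real (torusBall q.1 q.2)|) := by
  refine ⟨1, ?_⟩
  rintro _ ⟨q, rfl⟩
  have hv : IsProbabilityMeasure (volume : Measure (UnitAddTorus (Fin n))) :=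
    ⟨by rw [volume_pi, ← Set.pi_univ, Measure.pi_pi]; simp [AddCircle.measure_univ]⟩
  have h1 : ν.real (torusBall q.1 q.2) ≤ 1 := measureReal_le_one
  have h2 : (volume : Measure (UnitAddTorus (Fin n))).real (torusBall q.1 q.2) ≤ 1 :=
    measureReal_le_one
  rw [abs_le]
  constructor <;>
    linarith [measureReal_nonneg (μ := ν) (s := torusBall q.1 q.2),
      measureReal_nonneg (μ := (volume : Measure (UnitAddTorus (Fin n))))
        (s := torusBall q.1 q.2)]

end

/-!
The ball discrepancy of a probability measure `ν` on `𝕋ⁿ` is estimated by Fourier analysis. The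
indicator function of a ball of radius `R < 1/2` is squeezed between two smoothed balls
(`smoothedBall`): the images on the torus of the indicator functions of the Euclidean balls of
radius `R ± √n δ`, convolved with a product of tent functions of width `δ`
(`one_le_smoothedBall`, `smoothedBall_le_one`, `smoothedBall_eq_zero`). Pushing Euclidean balls
forward to the torus, instead of working with torus balls, keeps their Fourier transform explicit
even when the larger radius exceeds `1/2`. The two masses differ by `O(δ)`, and the frequency
`v ≠ 0` contributes at most (Fourier coefficient of the tents) × (Fourier transform of the ball)
× `|ν̂(v)|`; this is `exists_ballDiscrepancy_le`.

The Fourier transform of a ball is `O(‖v‖^{-(n+1)/2})`, uniformly for bounded radii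
(`exists_closedBall_fourier_bound`). By rotation and slicing it is a multiple of a Bessel integral
`∫_{-1}^1 (1 - t²)^a cos (l t) dt` with `a = (n - 1) / 2`, which satisfies a second order
differential equation; an almost conserved energy (`bddAbove_of_bessel_ode`) gives the decay
without any oscillatory integral estimate.

The tents have Fourier coefficients `O((1 + δ |k|)^{-2})`. Since `‖v‖` dominates the geometric mean
of the `max(1, |v_j|)`, the sum over frequencies is at most an `n`-th power of a sum over `ℤ`,
which is `O(1 + δ^{-(n-1)/(2n)})` (`summable_dampedWeight_and_tsum_le`).

For `ν = μ_G` the coefficient `ν̂(v)` is `S_G(v) / p^m`. The frequencies outside `p ℤⁿ` contribute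
`O(p^{-η} (1 + δ^{-(n-1)/2}))`; those in `p ℤⁿ` contribute, after the substitution `v = p w`, which
replaces `δ` by `p δ`, `O(p^{-(n+1)/2} (1 + (p δ)^{-(n-1)/2}))`. The choice
`δ = p^{-2 min(η, n)/(n+1)} / 2` makes all of these `O(δ)`.
-/

noncomputable section

/-! ### Decay of Bessel integrals -/

/-- The integral `∫_{-1}^1 (1 - t²)^a cos (l t) dt`; up to a power of `l` it is a Bessel function
of order `a + 1/2`. -/
def besselIntegral (a l : ℝ) : ℝ := ∫ t in (-1 : ℝ)..1, (1 - t ^ 2) ^ a * Real.cos (l * t)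

theorem hasDerivAt_integral_mul_cos {g : ℝ → ℝ} (hg : Continuous g) (l : ℝ) :
    HasDerivAt (fun l => ∫ t in (-1 : ℝ)..1, g t * Real.cos (l * t))
      (∫ t in (-1 : ℝ)..1, -(t * g t * Real.sin (l * t))) l := by
  refine (intervalIntegral.hasDerivAt_integral_of_dominated_loc_of_deriv_le (μ := volume)
    (F := fun l t => g t * Real.cos (l * t)) (F' := fun l t => -(t * g t * Real.sin (l * t)))
    (bound := fun t => |t * g t|) (s := Set.univ) Filter.univ_mem ?_ ?_ ?_ ?_ ?_ ?_).2
  · exact Filter.Eventually.of_forall fun x => (by fun_prop : Continuous _).aestronglyMeasurable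
  · exact (by fun_prop : Continuous _).intervalIntegrable _ _
  · exact (by fun_prop : Continuous _).aestronglyMeasurable
  · refine Filter.Eventually.of_forall fun t _ x _ => ?_
    rw [norm_neg, norm_mul, Real.norm_eq_abs]
    exact mul_le_of_le_one_right (abs_nonneg _) (Real.abs_sin_le_one _)
  · exact (by fun_prop : Continuous _).intervalIntegrable _ _
  · refine Filter.Eventually.of_forall fun t _ x _ => ?_
    have h := (((hasDerivAt_id x).mul_const t).cos).const_mul (g t)
    refine HasDerivAt.congr_deriv h ?_
    simp only [id_eq]; ring

theorem hasDerivAt_integral_mul_sin {g : ℝ → ℝ} (hg : Continuous g) (l : ℝ) :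
    HasDerivAt (fun l => ∫ t in (-1 : ℝ)..1, g t * Real.sin (l * t))
      (∫ t in (-1 : ℝ)..1, t * g t * Real.cos (l * t)) l := by
  refine (intervalIntegral.hasDerivAt_integral_of_dominated_loc_of_deriv_le (μ := volume)
    (F := fun l t => g t * Real.sin (l * t)) (F' := fun l t => t * g t * Real.cos (l * t))
    (bound := fun t => |t * g t|) (s := Set.univ) Filter.univ_mem ?_ ?_ ?_ ?_ ?_ ?_).2
  · exact Filter.Eventually.of_forall fun x => (by fun_prop : Continuous _).aestronglyMeasurable
  · exact (by fun_prop : Continuous _).intervalIntegrable _ _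
  · exact (by fun_prop : Continuous _).aestronglyMeasurable
  · refine Filter.Eventually.of_forall fun t _ x _ => ?_
    rw [norm_mul, Real.norm_eq_abs]
    exact mul_le_of_le_one_right (abs_nonneg _) (Real.abs_cos_le_one _)
  · exact (by fun_prop : Continuous _).intervalIntegrable _ _
  · refine Filter.Eventually.of_forall fun t _ x _ => ?_
    have h := (((hasDerivAt_id x).mul_const t).sin).const_mul (g t)
    refine HasDerivAt.congr_deriv h ?_
    simp only [id_eq]; ring

theorem continuous_one_sub_sq_rpow {a : ℝ} (ha : 0 ≤ a) :
    Continuous fun t : ℝ => (1 - t ^ 2) ^ a :=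
  (by fun_prop : Continuous fun t : ℝ => 1 - t ^ 2).rpow_const fun _ => Or.inr ha

/-- The integral with the weight `t² (1 - t²)^a` is minus the second derivative of
`besselIntegral a`; integration by parts turns it into Bessel's differential equation
`l (I + I'') = - 2 (a + 1) I'`. -/
theorem besselIntegral_ode {a : ℝ} (ha : 0 ≤ a) (l : ℝ) :
    l * (besselIntegral a l - ∫ t in (-1 : ℝ)..1, t * (t * (1 - t ^ 2) ^ a) * Real.cos (l * t)) =
      2 * (a + 1) * ∫ t in (-1 : ℝ)..1, t * (1 - t ^ 2) ^ a * Real.sin (l * t) := by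
  have hc := continuous_one_sub_sq_rpow ha
  have hd : ∀ t ∈ Set.uIcc (-1 : ℝ) 1, HasDerivAt
      (fun t : ℝ => (1 - t ^ 2) ^ (a + 1) * Real.sin (l * t))
      (l * ((1 - t ^ 2) ^ a * Real.cos (l * t) - t * (t * (1 - t ^ 2) ^ a) * Real.cos (l * t))
        - 2 * (a + 1) * (t * (1 - t ^ 2) ^ a * Real.sin (l * t))) t := by
    intro t ht
    rw [Set.uIcc_of_le (by norm_num)] at ht
    have h0 : 0 ≤ 1 - t ^ 2 := by nlinarith [ht.1, ht.2]
    have h1 := (((hasDerivAt_id t).pow 2).const_sub 1).rpow_const (p := a + 1)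
      (Or.inr (by linarith))
    have h2 := ((hasDerivAt_id t).const_mul l).sin
    have h3 := h1.mul h2
    refine HasDerivAt.congr_deriv h3 ?_
    simp only [id_eq, Pi.pow_apply, add_sub_cancel_right]
    rw [Real.rpow_add_one' h0 (by linarith)]
    push_cast
    ring
  have h := intervalIntegral.integral_eq_sub_of_hasDerivAt hd
    ((by fun_prop : Continuous _).intervalIntegrable _ _)
  have hz : (0 : ℝ) ^ (a + 1) = 0 := Real.zero_rpow (by linarith)
  rw [intervalIntegral.integral_sub, intervalIntegral.integral_const_mul,
    intervalIntegral.integral_const_mul, intervalIntegral.integral_sub] at h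
  · norm_num [hz] at h
    rw [besselIntegral]
    linarith
  all_goals exact (by fun_prop : Continuous _).intervalIntegrable _ _

theorem abs_besselIntegral_le {a : ℝ} (ha : 0 ≤ a) (l : ℝ) : |besselIntegral a l| ≤ 2 := by
  have h := intervalIntegral.norm_integral_le_of_norm_le_const (a := -1) (b := 1) (C := 1)
    (f := fun t : ℝ => (1 - t ^ 2) ^ a * Real.cos (l * t)) (fun t ht => by
      rw [Set.uIoc_of_le (by norm_num)] at ht
      have h0 : 0 ≤ 1 - t ^ 2 := by nlinarith [ht.1, ht.2]
      rw [norm_mul, Real.norm_of_nonneg (Real.rpow_nonneg h0 _), Real.norm_eq_abs]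
      exact mul_le_one₀ (Real.rpow_le_one h0 (by nlinarith [sq_nonneg t]) ha) (abs_nonneg _)
        (Real.abs_cos_le_one _))
  norm_num at h
  exact h

/-- A solution of `l (I + I'') = -(m + 1) I'` decays like `l^{-(m+1)/2}`. With
`E = l^{m+1} (I² + I'²) + (m + 1) l^m I I'` one has `E' = -(m + 1) l^{m-1} I I'`, which is
`O(l⁻² E)`, so that `E exp ((m + 1) / l)` decreases. -/
theorem bddAbove_of_bessel_ode (m : ℕ) (hm : 1 ≤ m) {I J K : ℝ → ℝ}
    (hI : ∀ l, HasDerivAt I (J l) l) (hJ : ∀ l, HasDerivAt J (K l) l)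
    (hode : ∀ l, l * (I l + K l) = -((m + 1) * J l)) :
    ∃ B, ∀ l, (m + 1 : ℝ) ≤ l → l ^ (m + 1) * I l ^ 2 ≤ B := by
  obtain ⟨k, rfl⟩ : ∃ k, m = k + 1 := ⟨m - 1, by omega⟩
  set c : ℝ := ((k + 1 : ℕ) : ℝ) + 1 with hc
  have hc0 : 0 < c := by positivity
  set E : ℝ → ℝ := fun l => l ^ (k + 2) * (I l ^ 2 + J l ^ 2) + c * (l ^ (k + 1) * (I l * J l))
    with hE
  have hEd : ∀ l, HasDerivAt E (-(c * (l ^ k * (I l * J l)))) l := by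
    intro l
    have h := ((hasDerivAt_pow (k + 2) l).mul (((hI l).pow 2).add ((hJ l).pow 2))).add
      (((hasDerivAt_pow (k + 1) l).mul ((hI l).mul (hJ l))).const_mul c)
    refine HasDerivAt.congr_deriv h ?_
    have h1 := hode l
    simp only [Pi.add_apply, Pi.pow_apply, Pi.mul_apply, Nat.add_one_sub_one]
    have hc' : (k : ℝ) = c - 2 := by rw [hc]; push_cast; ring
    push_cast
    rw [hc']
    have h2 : l * K l = -(c * J l) - l * I l := by linarith
    linear_combination (2 * l ^ (k + 1) * J l + c * l ^ k * I l) * h2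
  -- for `c ≤ l` the mixed term is absorbed by half of the main term
  have hElow : ∀ l, c ≤ l → l ^ (k + 2) * (I l ^ 2 + J l ^ 2) ≤ 2 * E l := by
    intro l hl
    have hl0 : 0 < l := hc0.trans_le hl
    have h1 : 0 ≤ l ^ (k + 1) * ((l - c) * (I l ^ 2 + J l ^ 2) + c * (I l + J l) ^ 2) := by
      have : 0 ≤ l - c := by linarith
      positivity
    have e : l ^ (k + 1) * ((l - c) * (I l ^ 2 + J l ^ 2) + c * (I l + J l) ^ 2) =
        2 * E l - l ^ (k + 2) * (I l ^ 2 + J l ^ 2) := by simp only [hE]; ring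
    linarith
  have hanti : AntitoneOn (fun l => E l * Real.exp (c * l⁻¹)) (Set.Ici c) := by
    have hd : ∀ l, 0 < l → HasDerivAt (fun l => E l * Real.exp (c * l⁻¹))
        (-(c * (l ^ k * (I l * J l))) * Real.exp (c * l⁻¹)
          + E l * (Real.exp (c * l⁻¹) * (c * -(l ^ 2)⁻¹))) l := fun l hl =>
      (hEd l).mul (((hasDerivAt_inv hl.ne').const_mul c).exp)
    refine antitoneOn_of_deriv_nonpos (convex_Ici c) ?_ ?_ ?_
    · exact fun l hl => (hd l (hc0.trans_le hl)).continuousAt.continuousWithinAt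
    · intro l hl
      rw [interior_Ici] at hl
      exact (hd l (hc0.trans hl)).differentiableAt.differentiableWithinAt
    · intro l hl
      rw [interior_Ici] at hl
      have hl0 : 0 < l := hc0.trans hl
      rw [(hd l hl0).deriv]
      have h1 := hElow l (le_of_lt hl)
      have h2 : -(l ^ k * (I l * J l)) ≤ E l * (l ^ 2)⁻¹ := by
        rw [← div_eq_mul_inv, le_div_iff₀ (by positivity)]
        have : 0 ≤ l ^ (k + 2) * (I l + J l) ^ 2 := by positivity
        have e : -(l ^ k * (I l * J l)) * l ^ 2 = -(l ^ (k + 2) * (I l * J l)) := by ring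
        nlinarith
      have h3 : -(c * (l ^ k * (I l * J l))) * Real.exp (c * l⁻¹)
          + E l * (Real.exp (c * l⁻¹) * (c * -(l ^ 2)⁻¹))
          = (c * Real.exp (c * l⁻¹)) * (-(l ^ k * (I l * J l)) - E l * (l ^ 2)⁻¹) := by ring
      rw [h3]
      exact mul_nonpos_of_nonneg_of_nonpos (by positivity) (by linarith)
  refine ⟨2 * (E c * Real.exp (c * c⁻¹)), fun l hl => ?_⟩
  have hl0 : 0 < l := hc0.trans_le hl
  have h1 : E l * Real.exp (c * l⁻¹) ≤ E c * Real.exp (c * c⁻¹) :=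
    hanti (Set.mem_Ici.2 le_rfl) (Set.mem_Ici.2 hl) hl
  have h2 := hElow l hl
  have h3 : 0 ≤ l ^ (k + 2) * J l ^ 2 := by positivity
  have h4 : 0 ≤ l ^ (k + 2) * I l ^ 2 := by positivity
  have h5 : E l ≤ E l * Real.exp (c * l⁻¹) :=
    le_mul_of_one_le_right (by linarith) (Real.one_le_exp (by positivity))
  have e : k + 1 + 1 = k + 2 := rfl
  rw [e]
  linarith

/-- Decay of `besselIntegral (m / 2)`: for large `l` from its differential equation, and for small
`l` from the trivial bound. -/
theorem exists_besselIntegral_bound (m : ℕ) (hm : 1 ≤ m) :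
    ∃ B, 0 < B ∧ ∀ l, 0 < l →
      |besselIntegral ((m : ℝ) / 2) l| ≤ B * l ^ (-(((m : ℝ) + 2) / 2)) := by
  set a : ℝ := (m : ℝ) / 2 with ha
  have ha0 : 0 ≤ a := by positivity
  have hc := continuous_one_sub_sq_rpow ha0
  have hJ : ∀ l, HasDerivAt
      (fun l => ∫ t in (-1 : ℝ)..1, -(t * (1 - t ^ 2) ^ a * Real.sin (l * t)))
      (-∫ t in (-1 : ℝ)..1, t * (t * (1 - t ^ 2) ^ a) * Real.cos (l * t)) l := by
    intro l
    simp only [intervalIntegral.integral_neg]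
    exact (hasDerivAt_integral_mul_sin (g := fun t => t * (1 - t ^ 2) ^ a) (by fun_prop) l).neg
  obtain ⟨B, hB⟩ := bddAbove_of_bessel_ode (m + 1) (by omega)
    (fun l => hasDerivAt_integral_mul_cos hc l) hJ (fun l => by
      have h := besselIntegral_ode ha0 l
      rw [intervalIntegral.integral_neg]
      have e : 2 * (a + 1) = (((m + 1 : ℕ) : ℝ) + 1) := by rw [ha]; push_cast; ring
      rw [e] at h
      simp only [besselIntegral] at h ⊢
      linarith)
  set c : ℝ := ((m + 1 : ℕ) : ℝ) + 1 with hcd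
  have hc1 : 1 ≤ c := by rw [hcd]; push_cast; linarith [Nat.cast_nonneg (α := ℝ) m]
  have key : ∀ l, 0 < l → l ^ (m + 2) * besselIntegral a l ^ 2 ≤ max B (c ^ (m + 2) * 4) := by
    intro l hl
    rcases le_total c l with h | h
    · exact (hB l h).trans (le_max_left _ _)
    · refine le_trans ?_ (le_max_right _ _)
      have h2 : besselIntegral a l ^ 2 ≤ 4 := by
        rw [← sq_abs]; nlinarith [abs_besselIntegral_le ha0 l, abs_nonneg (besselIntegral a l)]
      gcongr
  set D := max B (c ^ (m + 2) * 4)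
  have hD : 0 < D := lt_of_lt_of_le (by positivity) (le_max_right _ _)
  refine ⟨√D, Real.sqrt_pos.2 hD, fun l hl => ?_⟩
  rw [Real.rpow_neg hl.le, ← div_eq_mul_inv, le_div_iff₀ (by positivity)]
  refine Real.le_sqrt_of_sq_le ?_
  rw [mul_pow, sq_abs, ← Real.rpow_mul_natCast hl.le]
  have e : ((m : ℝ) + 2) / 2 * (2 : ℕ) = ((m + 2 : ℕ) : ℝ) := by push_cast; ring
  rw [e, Real.rpow_natCast, mul_comm]
  exact key l hl

/-! ### The Fourier transform of a Euclidean ball -/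

/-- Integration over a Euclidean ball of a function of the first coordinate, by slices: the slice
at height `t` is a ball of radius `√(R² - t²)` in one dimension less. -/
theorem setIntegral_closedBall_slice (m : ℕ) {R : ℝ} (hR : 0 ≤ R) {g : ℝ → ℝ}
    (hg : Continuous g) :
    ∫ u in Metric.closedBall (0 : EuclideanSpace ℝ (Fin (m + 1))) R, g (u 0) =
      volume.real (Metric.closedBall (0 : EuclideanSpace ℝ (Fin m)) 1) *
        ∫ t in (-R)..R, (R ^ 2 - t ^ 2) ^ ((m : ℝ) / 2) * g t := by
  set κ := volume.real (Metric.closedBall (0 : EuclideanSpace ℝ (Fin m)) 1)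
  have he1 := PiLp.volume_preserving_ofLp (Fin (m + 1))
  have he2 := volume_preserving_piFinSuccAbove (fun _ : Fin (m + 1) => ℝ) 0
  have he3 := (MeasurePreserving.id (volume : Measure ℝ)).prod (PiLp.volume_preserving_toLp (Fin m))
  let e : EuclideanSpace ℝ (Fin (m + 1)) ≃ᵐ ℝ × EuclideanSpace ℝ (Fin m) :=
    ((MeasurableEquiv.toLp 2 (Fin (m + 1) → ℝ)).symm.trans
      (MeasurableEquiv.piFinSuccAbove (fun _ : Fin (m + 1) => ℝ) 0)).trans
      ((MeasurableEquiv.refl ℝ).prodCongr (MeasurableEquiv.toLp 2 (Fin m → ℝ)))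
  have he : MeasurePreserving e (volume : Measure (EuclideanSpace ℝ (Fin (m + 1))))
      ((volume : Measure ℝ).prod (volume : Measure (EuclideanSpace ℝ (Fin m)))) :=
    he3.comp (he2.comp he1)
  have e_fst : ∀ u, (e u).1 = u 0 := fun u => rfl
  have e_snd : ∀ u i, (e u).2 i = u i.succ := fun u i => rfl
  set S : Set (ℝ × EuclideanSpace ℝ (Fin m)) := {q | q.1 ^ 2 + ‖q.2‖ ^ 2 ≤ R ^ 2} with hS
  have hSm : MeasurableSet S :=
    (isClosed_le (by fun_prop) continuous_const).measurableSet
  have hpre : e ⁻¹' S = Metric.closedBall 0 R := by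
    ext u
    rw [Set.mem_preimage, hS, Set.mem_ofPred_eq, mem_closedBall_zero_iff,
      ← pow_le_pow_iff_left₀ (norm_nonneg u) hR two_ne_zero, EuclideanSpace.norm_sq_eq,
      EuclideanSpace.norm_sq_eq, Fin.sum_univ_succ]
    simp only [e_fst, e_snd, Real.norm_eq_abs, sq_abs]
  have h1 : ∫ u in Metric.closedBall (0 : EuclideanSpace ℝ (Fin (m + 1))) R, g (u 0) =
      ∫ q in S, g q.1 ∂((volume : Measure ℝ).prod volume) := by
    rw [← hpre]
    exact he.setIntegral_preimage_emb e.measurableEmbedding (fun q => g q.1) S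
  have hint : Integrable (S.indicator fun q => g q.1)
      ((volume : Measure ℝ).prod (volume : Measure (EuclideanSpace ℝ (Fin m)))) := by
    rw [integrable_indicator_iff hSm, ← he.integrableOn_comp_preimage e.measurableEmbedding, hpre]
    have : Continuous fun u : EuclideanSpace ℝ (Fin (m + 1)) => g (u 0) := by fun_prop
    exact this.continuousOn.integrableOn_compact (isCompact_closedBall 0 R)
  rw [h1, ← integral_indicator hSm, integral_prod _ hint]
  have h2 : ∀ t : ℝ, ∫ y : EuclideanSpace ℝ (Fin m), S.indicator (fun q => g q.1) (t, y) =
      (Set.Icc (-R) R).indicator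
        (fun t => κ * ((R ^ 2 - t ^ 2) ^ ((m : ℝ) / 2) * g t)) t := by
    intro t
    by_cases ht : t ∈ Set.Icc (-R) R
    · have h0 : 0 ≤ R ^ 2 - t ^ 2 := by nlinarith [ht.1, ht.2]
      have hs : (fun y : EuclideanSpace ℝ (Fin m) => S.indicator (fun q => g q.1) (t, y)) =
          (Metric.closedBall 0 √(R ^ 2 - t ^ 2)).indicator fun _ => g t := by
        ext y
        have : (t, y) ∈ S ↔ y ∈ Metric.closedBall 0 √(R ^ 2 - t ^ 2) := by
          rw [mem_closedBall_zero_iff, Real.le_sqrt (norm_nonneg _) h0, hS, Set.mem_ofPred_eq]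
          constructor <;> intro h <;> linarith
        by_cases hy : y ∈ Metric.closedBall 0 √(R ^ 2 - t ^ 2)
        · rw [Set.indicator_of_mem hy, Set.indicator_of_mem (this.2 hy)]
        · rw [Set.indicator_of_notMem hy, Set.indicator_of_notMem (fun h => hy (this.1 h))]
      rw [hs, integral_indicator Metric.isClosed_closedBall.measurableSet, setIntegral_const,
        Measure.addHaar_real_closedBall' _ _ (Real.sqrt_nonneg _), Set.indicator_of_mem ht,
        finrank_euclideanSpace_fin, smul_eq_mul, Real.sqrt_eq_rpow, ← Real.rpow_mul_natCast h0]
      have : 1 / 2 * (m : ℝ) = m / 2 := by ring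
      rw [this]
      ring
    · rw [Set.indicator_of_notMem ht]
      have hs : (fun y : EuclideanSpace ℝ (Fin m) => S.indicator (fun q => g q.1) (t, y)) =
          fun _ => 0 := by
        ext y
        refine Set.indicator_of_notMem (fun h => ht ?_) _
        have h' : t ^ 2 + ‖y‖ ^ 2 ≤ R ^ 2 := h
        exact abs_le.1 (abs_le_of_sq_le_sq (by nlinarith [sq_nonneg ‖y‖]) hR)
      rw [hs, integral_zero]
  simp_rw [h2]
  rw [integral_indicator measurableSet_Icc, integral_const_mul, integral_Icc_eq_integral_Ioc,
    ← intervalIntegral.integral_of_le (by linarith)]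

/-- Invariance under rotations: the reflection that maps `v` to `‖v‖ e₀` reduces the inner product
with `v` to a multiple of the first coordinate. -/
theorem setIntegral_closedBall_inner (m : ℕ) (R : ℝ) (g : ℝ → ℝ)
    (v : EuclideanSpace ℝ (Fin (m + 1))) :
    ∫ u in Metric.closedBall (0 : EuclideanSpace ℝ (Fin (m + 1))) R, g (inner ℝ u v) =
      ∫ u in Metric.closedBall (0 : EuclideanSpace ℝ (Fin (m + 1))) R, g (‖v‖ * u 0) := by
  set w : EuclideanSpace ℝ (Fin (m + 1)) := EuclideanSpace.single 0 ‖v‖ with hw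
  have hvw : ‖v‖ = ‖w‖ := by simp [hw]
  set T := (ℝ ∙ (v - w))ᗮ.reflection with hT
  have hTv : T v = w := Submodule.reflection_sub hvw
  have h := T.measurePreserving.setIntegral_preimage_emb
    T.toHomeomorph.measurableEmbedding (fun u => g (‖v‖ * u 0))
    (Metric.closedBall (0 : EuclideanSpace ℝ (Fin (m + 1))) R)
  have hpre : T ⁻¹' (Metric.closedBall (0 : EuclideanSpace ℝ (Fin (m + 1))) R) =
      Metric.closedBall 0 R := by
    ext u; simp
  rw [hpre] at h
  rw [← h]
  refine setIntegral_congr_fun Metric.isClosed_closedBall.measurableSet fun u _ => ?_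
  have : inner ℝ u v = ‖v‖ * (T u) 0 := by
    rw [← T.inner_map_map u v, hTv, hw, EuclideanSpace.inner_single_right]
    simp
  simp only [this]

theorem setIntegral_closedBall_cos (m : ℕ) {R : ℝ} (hR : 0 < R)
    (v : EuclideanSpace ℝ (Fin (m + 1))) :
    ∫ u in Metric.closedBall (0 : EuclideanSpace ℝ (Fin (m + 1))) R,
        Real.cos (2 * Real.pi * inner ℝ u v) =
      volume.real (Metric.closedBall (0 : EuclideanSpace ℝ (Fin m)) 1) *
        (R ^ (m + 1) * besselIntegral ((m : ℝ) / 2) (2 * Real.pi * ‖v‖ * R)) := by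
  rw [setIntegral_closedBall_inner m R (fun s => Real.cos (2 * Real.pi * s)) v,
    setIntegral_closedBall_slice m hR.le (g := fun s => Real.cos (2 * Real.pi * (‖v‖ * s)))
      (by fun_prop)]
  congr 1
  have h := intervalIntegral.smul_integral_comp_mul_left (a := -1) (b := 1)
    (fun t : ℝ => (R ^ 2 - t ^ 2) ^ ((m : ℝ) / 2) * Real.cos (2 * Real.pi * (‖v‖ * t))) R
  rw [mul_neg, mul_one] at h
  rw [← h, smul_eq_mul, besselIntegral, pow_succ' R m, mul_assoc R,
    ← intervalIntegral.integral_const_mul (R ^ m)]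
  congr 1
  refine intervalIntegral.integral_congr fun t ht => ?_
  rw [Set.uIcc_of_le (by norm_num)] at ht
  have h0 : 0 ≤ 1 - t ^ 2 := by nlinarith [ht.1, ht.2]
  have e : R ^ 2 - (R * t) ^ 2 = R ^ 2 * (1 - t ^ 2) := by ring
  have e2 : (R ^ 2) ^ ((m : ℝ) / 2) = R ^ m := by
    rw [← Real.rpow_natCast_mul hR.le]
    push_cast
    rw [mul_div_cancel₀ _ (two_ne_zero), Real.rpow_natCast]
  rw [e, Real.mul_rpow (by positivity) h0, e2]
  ring_nf

/-- By the symmetry `u ↦ -u`, only the cosine contributes to the Fourier transform of a ball. -/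
theorem setIntegral_closedBall_cexp {n : ℕ} (R : ℝ) (v : EuclideanSpace ℝ (Fin n)) :
    ∫ u in Metric.closedBall (0 : EuclideanSpace ℝ (Fin n)) R,
        Complex.exp (-(2 * Real.pi * Complex.I * (inner ℝ u v : ℝ))) =
      ((∫ u in Metric.closedBall (0 : EuclideanSpace ℝ (Fin n)) R,
        Real.cos (2 * Real.pi * inner ℝ u v) : ℝ) : ℂ) := by
  set B := Metric.closedBall (0 : EuclideanSpace ℝ (Fin n)) R with hB
  have hneg : ∫ u in B, Complex.exp (-(2 * Real.pi * Complex.I * (inner ℝ u v : ℝ))) =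
      ∫ u in B, Complex.exp (2 * Real.pi * Complex.I * (inner ℝ u v : ℝ)) := by
    have h := (Measure.measurePreserving_neg
      (volume : Measure (EuclideanSpace ℝ (Fin n)))).setIntegral_preimage_emb
      (MeasurableEquiv.neg _).measurableEmbedding
      (fun u => Complex.exp (2 * Real.pi * Complex.I * (inner ℝ u v : ℝ))) B
    have hpre : Neg.neg ⁻¹' B = B := by ext u; simp [hB]
    rw [hpre] at h
    rw [← h]
    refine setIntegral_congr_fun Metric.isClosed_closedBall.measurableSet fun u _ => ?_
    simp [inner_neg_left]
  have hi : ∀ s : ℂ, IntegrableOn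
      (fun u => Complex.exp (s * (inner ℝ u v : ℝ))) B := fun s =>
    (by fun_prop : Continuous fun u : EuclideanSpace ℝ (Fin n) =>
      Complex.exp (s * (inner ℝ u v : ℝ))).continuousOn.integrableOn_compact
      (isCompact_closedBall 0 R)
  have hsum : ∫ u in B, (Complex.exp (-(2 * Real.pi * Complex.I * (inner ℝ u v : ℝ)))
      + Complex.exp (2 * Real.pi * Complex.I * (inner ℝ u v : ℝ))) =
      2 * ∫ u in B, ((Real.cos (2 * Real.pi * inner ℝ u v) : ℝ) : ℂ) := by
    rw [← integral_const_mul]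
    refine integral_congr_ae (Filter.Eventually.of_forall fun u => ?_)
    simp only [Complex.ofReal_cos, Complex.two_cos]
    push_cast
    rw [add_comm]
    ring_nf
  rw [integral_add
    (by simpa only [neg_mul, IntegrableOn] using hi (-(2 * Real.pi * Complex.I))) (hi _),
    ← hneg, ← two_mul] at hsum
  rw [mul_left_cancel₀ two_ne_zero hsum]
  exact integral_ofReal

/-- The Fourier transform of the indicator function of a ball of bounded radius decays like
`‖v‖^{-(n+1)/2}`, uniformly in the radius. -/
theorem exists_closedBall_fourier_bound {n : ℕ} (hn : 2 ≤ n) (R₀ : ℝ) :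
    ∃ K, 0 < K ∧ ∀ R ≤ R₀, ∀ v : EuclideanSpace ℝ (Fin n), v ≠ 0 →
      ‖∫ u in Metric.closedBall (0 : EuclideanSpace ℝ (Fin n)) R,
        Complex.exp (-(2 * Real.pi * Complex.I * (inner ℝ u v : ℝ)))‖ ≤
      K * ‖v‖ ^ (-(((n : ℝ) + 1) / 2)) := by
  obtain ⟨m, rfl⟩ : ∃ m, n = m + 1 := ⟨n - 1, by omega⟩
  obtain ⟨B, hB0, hB⟩ := exists_besselIntegral_bound m (by omega)
  set κ := volume.real (Metric.closedBall (0 : EuclideanSpace ℝ (Fin m)) 1) with hκ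
  have hκ0 : 0 ≤ κ := measureReal_nonneg
  set s : ℝ := ((m : ℝ) + 2) / 2 with hs
  have hs' : (((m + 1 : ℕ) : ℝ) + 1) / 2 = s := by rw [hs]; push_cast; ring
  refine ⟨κ * (max R₀ 1 ^ ((m : ℝ) / 2) * B) + 1, by positivity, fun R hR v hv => ?_⟩
  rw [hs']
  have hv0 : 0 < ‖v‖ := norm_pos_iff.2 hv
  -- a ball of radius `R ≤ 0` is a null set
  rcases le_or_gt R 0 with h0 | h0
  · have : volume (Metric.closedBall (0 : EuclideanSpace ℝ (Fin (m + 1))) R) = 0 := by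
      rcases h0.lt_or_eq with h | h
      · rw [Metric.closedBall_eq_empty.2 h, measure_empty]
      · rw [h, Metric.closedBall_zero, measure_singleton]
    rw [Measure.restrict_zero_set this, integral_zero_measure, norm_zero]
    positivity
  · rw [setIntegral_closedBall_cexp, setIntegral_closedBall_cos m h0, Complex.norm_real,
      Real.norm_eq_abs, abs_mul, abs_mul, abs_of_nonneg hκ0, abs_of_pos (pow_pos h0 _)]
    have hl : 0 < 2 * Real.pi * ‖v‖ * R := by positivity
    have h1 : R ^ (m + 1) * |besselIntegral ((m : ℝ) / 2) (2 * Real.pi * ‖v‖ * R)| ≤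
        max R₀ 1 ^ ((m : ℝ) / 2) * B * ‖v‖ ^ (-s) := by
      have h2 : (2 * Real.pi * ‖v‖ * R) ^ (-s) ≤ (‖v‖ * R) ^ (-s) := by
        refine Real.rpow_le_rpow_of_nonpos (by positivity) ?_
          (by rw [hs]; linarith [Nat.cast_nonneg (α := ℝ) m])
        have : 1 ≤ 2 * Real.pi := by linarith [Real.pi_gt_three]
        nlinarith [mul_pos hv0 h0]
      have h3 : R ^ (m + 1) * R ^ (-s) = R ^ ((m : ℝ) / 2) := by
        rw [← Real.rpow_natCast, ← Real.rpow_add h0]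
        congr 1
        rw [hs]; push_cast; ring
      calc R ^ (m + 1) * |besselIntegral ((m : ℝ) / 2) (2 * Real.pi * ‖v‖ * R)|
          ≤ R ^ (m + 1) * (B * (‖v‖ * R) ^ (-s)) := by
            gcongr
            exact (hB _ hl).trans (by gcongr)
        _ = R ^ ((m : ℝ) / 2) * B * ‖v‖ ^ (-s) := by
            rw [Real.mul_rpow hv0.le h0.le, ← h3]; ring
        _ ≤ _ := by
            gcongr
            exact hR.trans (le_max_left _ _)
    calc κ * (R ^ (m + 1) * |besselIntegral ((m : ℝ) / 2) (2 * Real.pi * ‖v‖ * R)|)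
        ≤ κ * (max R₀ 1 ^ ((m : ℝ) / 2) * B * ‖v‖ ^ (-s)) := by gcongr
      _ ≤ _ := by
        have : 0 ≤ ‖v‖ ^ (-s) := by positivity
        nlinarith

/-! ### Sums over frequencies -/

/-- Tangent line inequality for the concave function `x ↦ x ^ s`, at `x`. -/
theorem mul_rpow_sub_le_rpow_sub_rpow {s x y : ℝ} (hs0 : 0 ≤ s) (hs1 : s ≤ 1) (hx : 0 < x)
    (hy : 0 ≤ y) : s * x ^ (s - 1) * (x - y) ≤ x ^ s - y ^ s := by
  have h := rpow_one_add_le_one_add_mul_self (s := y / x - 1)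
    (by have : 0 ≤ y / x := by positivity
        linarith) hs0 hs1
  have h2 : y ^ s = x ^ s * (1 + (y / x - 1)) ^ s := by
    rw [← Real.mul_rpow hx.le (by rw [add_sub_cancel]; positivity), add_sub_cancel,
      mul_div_cancel₀ _ hx.ne']
  have h3 : x ^ s * (1 + (y / x - 1)) ^ s ≤ x ^ s * (1 + s * (y / x - 1)) := by gcongr
  have h4 : x ^ s * (1 + s * (y / x - 1)) = x ^ s - s * x ^ (s - 1) * (x - y) := by
    rw [Real.rpow_sub_one hx.ne']
    field_simp
    ring
  linarith

/-- The sum is compared with the telescoping sum of the increments of `(k / (1 + δ k)) ^ (1 - β)`,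
a sequence bounded by `δ ^ (β - 1)`. -/
theorem sum_range_rpow_mul_le {β δ : ℝ} (hβ0 : 0 ≤ β) (hβ1 : β < 1) (hδ : 0 < δ) (N : ℕ) :
    ∑ j ∈ Finset.range N, ((j : ℝ) + 1) ^ (-β) * ((1 + δ * ((j : ℝ) + 1)) ^ 2)⁻¹ ≤
      δ ^ (β - 1) / (1 - β) := by
  set x : ℕ → ℝ := fun j => j / (1 + δ * j) with hx
  have hterm : ∀ j : ℕ, ((j : ℝ) + 1) ^ (-β) * ((1 + δ * ((j : ℝ) + 1)) ^ 2)⁻¹ ≤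
      (x (j + 1) ^ (1 - β) - x j ^ (1 - β)) / (1 - β) := by
    intro j
    have hxp : 0 < x (j + 1) := by simp only [hx]; positivity
    have hx0 : 0 ≤ x j := by simp only [hx]; positivity
    have h := mul_rpow_sub_le_rpow_sub_rpow (s := 1 - β) (by linarith) (by linarith) hxp hx0
    rw [le_div_iff₀ (by linarith)]
    refine le_trans ?_ h
    have e : 1 - β - 1 = -β := by ring
    rw [e, mul_comm, mul_assoc]
    refine mul_le_mul_of_nonneg_left ?_ (by linarith)
    have h1 : ((j : ℝ) + 1) ^ (-β) ≤ x (j + 1) ^ (-β) := by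
      refine Real.rpow_le_rpow_of_nonpos hxp ?_ (by linarith)
      simp only [hx]
      push_cast
      refine div_le_self (by positivity) ?_
      have : 0 ≤ δ * ((j : ℝ) + 1) := by positivity
      linarith
    have h2 : ((1 + δ * ((j : ℝ) + 1)) ^ 2)⁻¹ ≤ x (j + 1) - x j := by
      have hp1 : 0 < 1 + δ * ((j : ℝ) + 1) := by positivity
      have hp2 : 0 < 1 + δ * (j : ℝ) := by positivity
      have : x (j + 1) - x j = ((1 + δ * ((j : ℝ) + 1)) * (1 + δ * j))⁻¹ := by
        simp only [hx]
        push_cast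
        field_simp
        ring
      rw [this, sq]
      gcongr
      linarith
    exact mul_le_mul h1 h2 (by positivity) (by positivity)
  refine (Finset.sum_le_sum fun j _ => hterm j).trans ?_
  rw [← Finset.sum_div, Finset.sum_range_sub (fun j => x j ^ (1 - β))]
  have hx00 : x 0 = 0 := by simp [hx]
  rw [hx00, Real.zero_rpow (by linarith), sub_zero]
  have hb : x N ≤ δ⁻¹ := by
    simp only [hx]
    rw [div_le_iff₀ (by positivity)]
    have : δ⁻¹ * (1 + δ * N) = δ⁻¹ + N := by field_simp
    rw [this]
    have : 0 < δ⁻¹ := by positivity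
    linarith
  have : δ ^ (β - 1) = δ⁻¹ ^ (1 - β) := by
    rw [Real.inv_rpow hδ.le, ← Real.rpow_neg hδ.le, neg_sub]
  rw [this]
  have hxN : 0 ≤ x N := by simp only [hx]; positivity
  have : 0 < 1 - β := by linarith
  gcongr

/-- The weight `max(1, |k|)^{-β} (1 + δ |k|)^{-2}` on `ℤ`, whose sum is `O(1 + δ^{β-1})`. -/
def dampedWeight (β δ : ℝ) (k : ℤ) : ℝ :=
  max 1 |(k : ℝ)| ^ (-β) * ((1 + δ * |(k : ℝ)|) ^ 2)⁻¹

theorem dampedWeight_nonneg (β : ℝ) {δ : ℝ} (k : ℤ) : 0 ≤ dampedWeight β δ k := by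
  unfold dampedWeight; positivity

theorem summable_dampedWeight_and_tsum_le {β δ : ℝ} (hβ0 : 0 ≤ β) (hβ1 : β < 1) (hδ : 0 < δ) :
    Summable (dampedWeight β δ) ∧
      ∑' k, dampedWeight β δ k ≤ (2 / (1 - β)) * (1 + δ ^ (β - 1)) := by
  set f : ℕ → ℝ := fun j => ((j : ℝ) + 1) ^ (-β) * ((1 + δ * ((j : ℝ) + 1)) ^ 2)⁻¹ with hf
  have hf0 : ∀ j, 0 ≤ f j := fun j => by simp only [hf]; positivity
  have hs : Summable f := summable_of_sum_range_le hf0 (sum_range_rpow_mul_le hβ0 hβ1 hδ)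
  have hle : ∑' j, f j ≤ δ ^ (β - 1) / (1 - β) :=
    Real.tsum_le_of_sum_range_le hf0 (sum_range_rpow_mul_le hβ0 hβ1 hδ)
  have hw : ∀ j : ℕ, |(j : ℝ) + 1| = j + 1 := fun j => abs_of_pos (by positivity)
  have hw2 : ∀ j : ℕ, |-((j : ℝ) + 1)| = j + 1 := fun j => by rw [abs_neg, hw]
  have hw3 : ∀ j : ℕ, max 1 ((j : ℝ) + 1) = j + 1 := fun j => 
    max_eq_right (by linarith [Nat.cast_nonneg (α := ℝ) j])
  have h1 : HasSum (fun j : ℕ => dampedWeight β δ (j + 1)) (∑' j, f j) := by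
    convert hs.hasSum using 2 with j
    simp only [dampedWeight, hf]
    push_cast
    rw [hw, hw3]
  have h2 : HasSum (fun j : ℕ => dampedWeight β δ (-(j + 1))) (∑' j, f j) := by
    convert hs.hasSum using 2 with j
    simp only [dampedWeight, hf]
    push_cast
    rw [hw2, hw3]
  have h0 : dampedWeight β δ 0 = 1 := by simp [dampedWeight]
  have h := HasSum.of_add_one_of_neg_add_one h1 h2
  refine ⟨h.summable, ?_⟩
  rw [h.tsum_eq, h0]
  have : 0 < 1 - β := by linarith
  have h3 : 1 ≤ 2 / (1 - β) := by rw [le_div_iff₀ this]; linarith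
  have h4 : 2 / (1 - β) * δ ^ (β - 1) = 2 * (δ ^ (β - 1) / (1 - β)) := by ring
  rw [mul_add, h4]
  linarith

/-- Distributivity of infinite sums over finite products. -/
theorem hasSum_pi_prod {𝕜 : Type*} [NormedField 𝕜] [CompleteSpace 𝕜] {κ : Type*} {n : ℕ}
    {f : Fin n → κ → 𝕜} {a : Fin n → 𝕜} (hf : ∀ i, HasSum (f i) (a i))
    (hf' : ∀ i, Summable fun k => ‖f i k‖) :
    HasSum (fun v : Fin n → κ => ∏ i, f i (v i)) (∏ i, a i) ∧
      Summable fun v : Fin n → κ => ‖∏ i, f i (v i)‖ := by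
  induction n with
  | zero =>
    simp only [Finset.univ_eq_empty, Finset.prod_empty, norm_one]
    exact ⟨hasSum_unique _, (hasSum_unique _).summable⟩
  | succ n ih =>
    obtain ⟨h1, h2⟩ := ih (fun i => hf i.succ) (fun i => hf' i.succ)
    let e : (Fin (n + 1) → κ) ≃ κ × (Fin n → κ) :=
      { toFun := fun v => (v 0, fun i => v i.succ)
        invFun := fun q => Fin.cons q.1 q.2
        left_inv := fun v => Fin.cons_self_tail v
        right_inv := fun q => by simp }
    have hfun : (fun v : Fin (n + 1) → κ => ∏ i, f i (v i)) =
        (fun q : κ × (Fin n → κ) => f 0 q.1 * ∏ i : Fin n, f i.succ (q.2 i)) ∘ e := by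
      ext v
      rw [Function.comp_apply, Fin.prod_univ_succ]
      rfl
    set g : (Fin n → κ) → 𝕜 := fun w => ∏ i : Fin n, f i.succ (w i)
    have h3 : Summable fun q : κ × (Fin n → κ) => ‖f 0 q.1 * g q.2‖ :=
      Summable.mul_norm (f := f 0) (g := g) (hf' 0) h2
    constructor
    · rw [Fin.prod_univ_succ, hfun, e.hasSum_iff]
      exact HasSum.mul (f := f 0) (g := g) (hf 0) h1 h3.of_norm
    · refine (e.summable_iff.2 h3).congr fun v => ?_
      exact congrArg norm (congrFun hfun v).symm

/-! ### Tent functions on the torus -/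

/-- The tent of half-width `δ` on the circle `ℝ/ℤ`; its mass is `1` if `0 < δ ≤ 1/2`. -/
def tent (δ : ℝ) (x : UnitAddCircle) : ℝ := δ⁻¹ * max 0 (1 - ‖x‖ / δ)

/-- The Fourier coefficients of `tent δ`, for `0 < δ ≤ 1/2`. -/
def tentCoeff (δ : ℝ) (k : ℤ) : ℝ :=
  if k = 0 then 1 else 2 * (1 - Real.cos (2 * Real.pi * k * δ)) / (2 * Real.pi * k * δ) ^ 2

theorem continuous_tent (δ : ℝ) : Continuous (tent δ) := by
  unfold tent; fun_prop

theorem tent_nonneg {δ : ℝ} (hδ : 0 < δ) (x : UnitAddCircle) : 0 ≤ tent δ x := by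
  unfold tent; positivity

theorem norm_lt_of_tent_ne_zero {δ : ℝ} (hδ : 0 < δ) {x : UnitAddCircle} (hx : tent δ x ≠ 0) :
    ‖x‖ < δ := by
  by_contra! h
  refine hx ?_
  rw [tent, max_eq_left, mul_zero]
  have : 1 ≤ ‖x‖ / δ := by rwa [one_le_div hδ]
  linarith

theorem tent_coe {δ t : ℝ} (ht : |t| ≤ 1 / 2) :
    tent δ (t : UnitAddCircle) = δ⁻¹ * max 0 (1 - |t| / δ) := by
  rw [tent, (AddCircle.norm_coe_eq_abs_iff 1 one_ne_zero).2 (by simpa using ht)]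

theorem tentCoeff_nonneg (δ : ℝ) (k : ℤ) : 0 ≤ tentCoeff δ k := by
  unfold tentCoeff
  split_ifs
  · exact zero_le_one
  · have := Real.cos_le_one (2 * Real.pi * k * δ)
    have : 0 ≤ 1 - Real.cos (2 * Real.pi * k * δ) := by linarith
    positivity

theorem tentCoeff_le {δ : ℝ} (hδ : 0 < δ) (k : ℤ) :
    tentCoeff δ k ≤ 4 * ((1 + δ * |(k : ℝ)|) ^ 2)⁻¹ := by
  unfold tentCoeff
  split_ifs with hk
  · simp [hk]
  · have hk' : 0 < |(k : ℝ)| := abs_pos.2 (Int.cast_ne_zero.2 hk)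
    set x := δ * |(k : ℝ)| with hx
    have hx0 : 0 < x := by positivity
    have e : (2 * Real.pi * k * δ) ^ 2 = (2 * Real.pi) ^ 2 * x ^ 2 := by
      rw [hx, mul_pow, mul_pow, mul_pow δ, sq_abs]; ring
    have hpi : 36 ≤ (2 * Real.pi) ^ 2 := by nlinarith [Real.pi_gt_three]
    rw [← div_eq_mul_inv, div_le_div_iff₀ (by rw [e]; positivity) (by positivity)]
    rcases le_total x 1 with h | h
    · have h1 := Real.one_sub_sq_div_two_le_cos (x := 2 * Real.pi * k * δ)
      have h2 : 2 * (1 - Real.cos (2 * Real.pi * k * δ)) ≤ (2 * Real.pi * k * δ) ^ 2 := by linarith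
      have h3 : (1 + x) ^ 2 ≤ 4 := by nlinarith
      calc _ ≤ (2 * Real.pi * k * δ) ^ 2 * 4 := by gcongr
        _ = _ := mul_comm _ _
    · have h1 := Real.neg_one_le_cos (2 * Real.pi * k * δ)
      have h2 : 2 * (1 - Real.cos (2 * Real.pi * k * δ)) ≤ 4 := by linarith
      have h3 : (1 + x) ^ 2 ≤ 4 * x ^ 2 := by nlinarith
      calc _ ≤ 4 * (1 + x) ^ 2 := by gcongr
        _ ≤ 4 * (2 * Real.pi * k * δ) ^ 2 := by
          rw [e]
          nlinarith [sq_nonneg x]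

theorem integral_cos_mul_tent {δ : ℝ} (hδ : 0 < δ) (k : ℤ) :
    ∫ x in (0 : ℝ)..δ, 2 * Real.cos (2 * Real.pi * k * x) * (δ⁻¹ * (1 - x / δ)) =
      tentCoeff δ k := by
  unfold tentCoeff
  split_ifs with hk
  · have hd : ∀ x ∈ Set.uIcc 0 δ, HasDerivAt (fun x : ℝ => 2 * δ⁻¹ * (x - x ^ 2 / 2 / δ))
        (2 * Real.cos (2 * Real.pi * k * x) * (δ⁻¹ * (1 - x / δ))) x := by
      intro x _
      have h := ((hasDerivAt_id x).sub (((hasDerivAt_pow 2 x).div_const 2).div_const δ)).const_mul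
        (2 * δ⁻¹)
      refine HasDerivAt.congr_deriv h ?_
      simp [hk]
      ring
    rw [intervalIntegral.integral_eq_sub_of_hasDerivAt hd
      ((by fun_prop : Continuous _).intervalIntegrable _ _)]
    field_simp
    ring
  · set A : ℝ := 2 * Real.pi * k with hA
    have hA0 : A ≠ 0 := by
      have : (k : ℝ) ≠ 0 := Int.cast_ne_zero.2 hk
      positivity
    have hd : ∀ x ∈ Set.uIcc 0 δ, HasDerivAt
        (fun x : ℝ => 2 * δ⁻¹ *
          ((1 - x / δ) * (Real.sin (A * x) / A) - Real.cos (A * x) / (δ * A ^ 2)))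
        (2 * Real.cos (A * x) * (δ⁻¹ * (1 - x / δ))) x := by
      intro x _
      have h1 := ((hasDerivAt_id x).div_const δ).const_sub 1
      have h2 := (((hasDerivAt_id x).const_mul A).sin).div_const A
      have h3 := (((hasDerivAt_id x).const_mul A).cos).div_const (δ * A ^ 2)
      have h := ((h1.mul h2).sub h3).const_mul (2 * δ⁻¹)
      refine HasDerivAt.congr_deriv h ?_
      simp only [id_eq]
      field_simp
      ring
    rw [intervalIntegral.integral_eq_sub_of_hasDerivAt hd
      ((by fun_prop : Continuous _).intervalIntegrable _ _)]
    rw [mul_zero, Real.cos_zero, Real.sin_zero]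
    field_simp
    ring

theorem fourierCoeff_tent {δ : ℝ} (hδ : 0 < δ) (hδ' : δ ≤ 1 / 2) (k : ℤ) :
    fourierCoeff (fun x : UnitAddCircle => (tent δ x : ℂ)) k = tentCoeff δ k := by
  set F : ℝ → ℂ := fun x => fourier (-k) (x : UnitAddCircle) • (tent δ (x : UnitAddCircle) : ℂ)
    with hF
  have hFc : Continuous F := by
    have h1 : Continuous fun x : ℝ => (x : UnitAddCircle) := AddCircle.continuous_mk' 1
    have h2 := (continuous_tent δ).comp h1
    have h3 := (map_continuous (fourier (T := 1) (-k))).comp h1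
    exact h3.smul (Complex.continuous_ofReal.comp h2)
  have hsym : ∀ x : ℝ, |x| ≤ 1 / 2 → F (-x) + F x =
      ((2 * Real.cos (2 * Real.pi * k * x) * (δ⁻¹ * max 0 (1 - |x| / δ)) : ℝ) : ℂ) := by
    intro x hx
    simp only [hF, smul_eq_mul]
    rw [tent_coe hx, tent_coe (by rwa [abs_neg]), abs_neg, ← add_mul]
    rw [fourier_coe_apply, fourier_coe_apply]
    push_cast
    rw [Complex.two_cos]
    congr 2 <;> congr 1 <;> ring
  rw [fourierCoeff_eq_intervalIntegral _ k (-(1 / 2))]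
  have e : -(1 / 2 : ℝ) + 1 = 1 / 2 := by norm_num
  rw [e, div_one, one_smul]
  change ∫ x in (-(1 / 2 : ℝ))..(1 / 2), F x = _
  rw [← intervalIntegral.integral_add_adjacent_intervals (b := 0)
    (hFc.intervalIntegrable _ _) (hFc.intervalIntegrable _ _)]
  have h1 : ∫ x in (-(1 / 2 : ℝ))..0, F x = ∫ x in (0 : ℝ)..(1 / 2), F (-x) := by
    rw [intervalIntegral.integral_comp_neg, neg_zero]
  have hFn : Continuous fun x => F (-x) := hFc.comp continuous_neg
  rw [h1, ← intervalIntegral.integral_add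
    (hFn.intervalIntegrable _ _) (hFc.intervalIntegrable _ _)]
  have h2 : ∫ x in (0 : ℝ)..(1 / 2), (F (-x) + F x) = ∫ x in (0 : ℝ)..(1 / 2),
      ((2 * Real.cos (2 * Real.pi * k * x) * (δ⁻¹ * max 0 (1 - |x| / δ)) : ℝ) : ℂ) := by
    refine intervalIntegral.integral_congr fun x hx => ?_
    rw [Set.uIcc_of_le (by norm_num)] at hx
    exact hsym x (by rw [abs_of_nonneg hx.1]; exact hx.2)
  rw [h2, intervalIntegral.integral_ofReal, ← integral_cos_mul_tent hδ k]
  congr 1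
  have hc : Continuous fun x : ℝ =>
    2 * Real.cos (2 * Real.pi * k * x) * (δ⁻¹ * max 0 (1 - |x| / δ)) := by fun_prop
  rw [← intervalIntegral.integral_add_adjacent_intervals (b := δ)
    (hc.intervalIntegrable _ _) (hc.intervalIntegrable _ _)]
  have h3 : ∫ x in δ..(1 / 2),
      2 * Real.cos (2 * Real.pi * k * x) * (δ⁻¹ * max 0 (1 - |x| / δ)) = 0 := by
    refine (intervalIntegral.integral_congr (g := fun _ => (0 : ℝ)) fun x hx => ?_).trans
      intervalIntegral.integral_zero
    rw [Set.uIcc_of_le hδ'] at hx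
    have : 1 ≤ |x| / δ := by
      rw [one_le_div hδ]; exact hx.1.trans (le_abs_self x)
    rw [max_eq_left (by linarith)]
    ring
  rw [h3, add_zero]
  refine intervalIntegral.integral_congr fun x hx => ?_
  rw [Set.uIcc_of_le hδ.le] at hx
  have : x / δ ≤ 1 := by rw [div_le_one hδ]; exact hx.2
  rw [abs_of_nonneg hx.1, max_eq_right (by linarith)]

theorem summable_tentCoeff {δ : ℝ} (hδ : 0 < δ) : Summable (tentCoeff δ) := by
  have h := (summable_dampedWeight_and_tsum_le (β := 0) le_rfl zero_lt_one hδ).1.mul_left 4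
  refine Summable.of_nonneg_of_le (tentCoeff_nonneg δ) (fun k => ?_) h
  simpa [dampedWeight] using tentCoeff_le hδ k

theorem hasSum_tent {δ : ℝ} (hδ : 0 < δ) (hδ' : δ ≤ 1 / 2) (x : UnitAddCircle) :
    HasSum (fun k => (tentCoeff δ k : ℂ) * fourier k x) (tent δ x) := by
  set f : C(UnitAddCircle, ℂ) :=
    ⟨fun x => (tent δ x : ℂ), Complex.continuous_ofReal.comp (continuous_tent δ)⟩ with hf
  have hc : fourierCoeff f = fun k => (tentCoeff δ k : ℂ) :=
    funext fun k => fourierCoeff_tent hδ hδ' k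
  have hs : Summable (fourierCoeff f) := by
    rw [hc]
    exact Complex.ofRealCLM.summable (summable_tentCoeff hδ)
  have h := has_pointwise_sum_fourier_series_of_summable hs x
  rw [hc] at h
  exact h

theorem integral_tent {δ : ℝ} (hδ : 0 < δ) (hδ' : δ ≤ 1 / 2) :
    ∫ x : UnitAddCircle, tent δ x = 1 := by
  have h := fourierCoeff_tent hδ hδ' 0
  rw [fourierCoeff_eq_intervalIntegral _ 0 0, zero_add, div_one, one_smul] at h
  simp only [neg_zero, fourier_zero, one_smul, tentCoeff, if_true] at h
  rw [intervalIntegral.integral_ofReal] at h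
  have h2 := UnitAddCircle.intervalIntegral_preimage 0 (tent δ)
  rw [zero_add] at h2
  rw [← h2]
  exact_mod_cast h

/-- The product tent on the torus: a nonnegative function supported where all coordinates are at
distance at most `δ` from `0`, with integral `1` and an absolutely convergent Fourier series for
`0 < δ ≤ 1/2`. -/
def tentProd {n : ℕ} (δ : ℝ) (x : UnitAddTorus (Fin n)) : ℝ := ∏ j, tent δ (x j)

/-- The Fourier coefficients of `tentProd δ`, for `0 < δ ≤ 1/2`. -/
def tentProdCoeff {n : ℕ} (δ : ℝ) (v : Fin n → ℤ) : ℝ := ∏ j, tentCoeff δ (v j)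

theorem continuous_tentProd {n : ℕ} (δ : ℝ) : Continuous (tentProd (n := n) δ) :=
  continuous_finsetProd _ fun j _ => (continuous_tent δ).comp (continuous_apply j)

theorem tentProd_nonneg {n : ℕ} {δ : ℝ} (hδ : 0 < δ) (x : UnitAddTorus (Fin n)) :
    0 ≤ tentProd δ x := Finset.prod_nonneg fun _ _ => tent_nonneg hδ _

theorem norm_lt_of_tentProd_ne_zero {n : ℕ} {δ : ℝ} (hδ : 0 < δ) {x : UnitAddTorus (Fin n)}
    (hx : tentProd δ x ≠ 0) (j : Fin n) : ‖x j‖ < δ :=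
  norm_lt_of_tent_ne_zero hδ (Finset.prod_ne_zero_iff.1 hx j (Finset.mem_univ j))

theorem tentProdCoeff_nonneg {n : ℕ} (δ : ℝ) (v : Fin n → ℤ) : 0 ≤ tentProdCoeff δ v :=
  Finset.prod_nonneg fun _ _ => tentCoeff_nonneg δ _

theorem tentProdCoeff_zero (n : ℕ) (δ : ℝ) : tentProdCoeff δ (0 : Fin n → ℤ) = 1 := by
  simp [tentProdCoeff, tentCoeff]

theorem summable_tentProdCoeff (n : ℕ) {δ : ℝ} (hδ : 0 < δ) :
    Summable (tentProdCoeff (n := n) δ) :=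
  (hasSum_pi_prod (fun _ : Fin n => (summable_tentCoeff hδ).hasSum)
    fun _ => (summable_tentCoeff hδ).norm).1.summable

theorem hasSum_tentProd {n : ℕ} {δ : ℝ} (hδ : 0 < δ) (hδ' : δ ≤ 1 / 2)
    (x : UnitAddTorus (Fin n)) :
    HasSum (fun v => (tentProdCoeff δ v : ℂ) * UnitAddTorus.mFourier v x) (tentProd δ x) := by
  have h := (hasSum_pi_prod (fun j : Fin n => hasSum_tent hδ hδ' (x j)) fun j => by
    refine (summable_tentCoeff hδ).congr fun k => ?_
    rw [norm_mul, Complex.norm_real, Real.norm_of_nonneg (tentCoeff_nonneg δ k), fourier_apply,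
      Circle.norm_coe, mul_one]).1
  have e : ((tentProd δ x : ℝ) : ℂ) = ∏ j, (tent δ (x j) : ℂ) := by
    rw [tentProd]; push_cast; rfl
  rw [e]
  have hv : (fun v : Fin n → ℤ => (tentProdCoeff δ v : ℂ) * UnitAddTorus.mFourier v x) =
      fun v => ∏ j, (tentCoeff δ (v j) : ℂ) * fourier (v j) (x j) := by
    ext v
    rw [Finset.prod_mul_distrib, tentProdCoeff]
    push_cast
    rfl
  rw [hv]
  exact h

/-- The translates of `tentProd δ` have integral `1` over every unit cube. -/
theorem setIntegral_cube_tentProd {n : ℕ} {δ : ℝ} (hδ : 0 < δ) (hδ' : δ ≤ 1 / 2)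
    (z : UnitAddTorus (Fin n)) (a : Fin n → ℝ) :
    ∫ u in Set.univ.pi fun j => Set.Ioc (a j) (a j + 1),
      tentProd δ (z - fun j => (u j : UnitAddCircle)) = 1 := by
  rw [volume_pi, Measure.restrict_pi_pi]
  simp only [tentProd, Pi.sub_apply]
  rw [integral_fintype_prod_eq_prod (𝕜 := ℝ)
    (f := fun j (s : ℝ) => tent δ (z j - (s : UnitAddCircle)))]
  refine Finset.prod_eq_one fun j _ => ?_
  rw [UnitAddCircle.integral_preimage (a j) (fun b => tent δ (z j - b)),
    integral_sub_left_eq_self (tent δ) volume (z j), integral_tent hδ hδ']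

/-! ### Smoothed balls -/

/-- The covering map `ℝⁿ → 𝕋ⁿ`. -/
def torusMk {n : ℕ} (u : EuclideanSpace ℝ (Fin n)) : UnitAddTorus (Fin n) :=
  fun j => (u j : UnitAddCircle)

theorem continuous_torusMk {n : ℕ} : Continuous (torusMk (n := n)) :=
  continuous_pi fun j => (AddCircle.continuous_mk' 1).comp (by fun_prop)

/-- The image on the torus of the indicator function of the Euclidean ball of radius `R` about `0`
(with overlaps counted), convolved with the tent function of width `δ`. -/
def smoothedBall {n : ℕ} (δ R : ℝ) (z : UnitAddTorus (Fin n)) : ℝ :=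
  ∫ u in Metric.closedBall (0 : EuclideanSpace ℝ (Fin n)) R, tentProd δ (z - torusMk u)

theorem exists_abs_le_half_coe_eq (z : UnitAddCircle) :
    ∃ t : ℝ, |t| ≤ 1 / 2 ∧ (t : UnitAddCircle) = z ∧ ‖z‖ = |t| := by
  induction z using QuotientAddGroup.induction_on with
  | H x =>
    refine ⟨x - round x, abs_sub_round x, ?_, UnitAddCircle.norm_eq⟩
    rw [AddCircle.coe_sub]
    have : ((round x : ℝ) : UnitAddCircle) = 0 := by
      rw [AddCircle.coe_eq_zero_iff]
      exact ⟨round x, by simp⟩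
    rw [this, sub_zero]

theorem norm_coe_unitAddCircle_le (t : ℝ) : ‖(t : UnitAddCircle)‖ ≤ |t| := by
  rw [UnitAddCircle.norm_eq]
  simpa using round_le t 0

theorem euclideanSpace_norm_le_of_abs_le {n : ℕ} {δ : ℝ} (hδ : 0 ≤ δ)
    {u : EuclideanSpace ℝ (Fin n)} (hu : ∀ j, |u j| ≤ δ) : ‖u‖ ≤ √n * δ := by
  rw [EuclideanSpace.norm_eq]
  refine Real.sqrt_le_iff.2 ⟨by positivity, ?_⟩
  rw [mul_pow, Real.sq_sqrt (Nat.cast_nonneg n)]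
  calc ∑ j, ‖u j‖ ^ 2 ≤ ∑ _j : Fin n, δ ^ 2 := by
        refine Finset.sum_le_sum fun j _ => ?_
        have := hu j
        rw [Real.norm_eq_abs]
        gcongr
    _ = n * δ ^ 2 := by simp

/-- The unit cube `∏ (a_j, a_j + 1]`, a fundamental domain of the torus. -/
def unitCube {n : ℕ} (a : Fin n → ℝ) : Set (EuclideanSpace ℝ (Fin n)) :=
  {u | ∀ j, u j ∈ Set.Ioc (a j) (a j + 1)}

theorem measurableSet_unitCube {n : ℕ} (a : Fin n → ℝ) : MeasurableSet (unitCube a) := by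
  have : unitCube a = ⋂ j, (fun u : EuclideanSpace ℝ (Fin n) => u j) ⁻¹'
      Set.Ioc (a j) (a j + 1) := by
    ext u; simp [unitCube]
  rw [this]
  exact MeasurableSet.iInter fun j =>
    (by fun_prop : Measurable fun u : EuclideanSpace ℝ (Fin n) => u j) measurableSet_Ioc

theorem setIntegral_unitCube_tentProd {n : ℕ} {δ : ℝ} (hδ : 0 < δ) (hδ' : δ ≤ 1 / 2)
    (z : UnitAddTorus (Fin n)) (a : Fin n → ℝ) :
    ∫ u in unitCube a, tentProd δ (z - torusMk u) = 1 := by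
  have h := (PiLp.volume_preserving_ofLp (Fin n)).setIntegral_preimage_emb
    (MeasurableEquiv.toLp 2 (Fin n → ℝ)).symm.measurableEmbedding
    (fun u => tentProd δ (z - fun j => (u j : UnitAddCircle)))
    (Set.univ.pi fun j => Set.Ioc (a j) (a j + 1))
  rw [setIntegral_cube_tentProd hδ hδ'] at h
  have hs : unitCube a = (@WithLp.ofLp 2 (Fin n → ℝ)) ⁻¹'
      (Set.univ.pi fun j => Set.Ioc (a j) (a j + 1)) := by
    ext u; simp [unitCube]
  rw [hs]
  exact h

theorem continuous_tentProd_sub {n : ℕ} (δ : ℝ) (z : UnitAddTorus (Fin n)) :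
    Continuous fun u => tentProd δ (z - torusMk u) :=
  (continuous_tentProd δ).comp (continuous_const.sub continuous_torusMk)

theorem smoothedBall_nonneg {n : ℕ} {δ : ℝ} (hδ : 0 < δ) (R : ℝ) (z : UnitAddTorus (Fin n)) :
    0 ≤ smoothedBall δ R z :=
  integral_nonneg fun _ => tentProd_nonneg hδ _

/-- The ball of radius `R + √n δ`, smoothed at scale `δ`, majorizes the torus ball of radius `R`. -/
theorem one_le_smoothedBall {n : ℕ} {δ R : ℝ} (hδ : 0 < δ) (hδ' : δ ≤ 1 / 2)
    {z : UnitAddTorus (Fin n)} (hz : √(∑ j, ‖z j‖ ^ 2) ≤ R) :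
    1 ≤ smoothedBall δ (R + √n * δ) z := by
  choose t ht1 ht2 ht3 using fun j => exists_abs_le_half_coe_eq (z j)
  set a : Fin n → ℝ := fun j => t j - 1 / 2 with ha
  rw [← setIntegral_unitCube_tentProd hδ hδ' z a, smoothedBall]
  have hB : MeasurableSet (Metric.closedBall (0 : EuclideanSpace ℝ (Fin n)) (R + √n * δ)) :=
    Metric.isClosed_closedBall.measurableSet
  -- on the unit cube centred at the lift of `z`, the integrand is supported in the ball
  have hsupp : ∀ u ∈ unitCube a, tentProd δ (z - torusMk u) ≠ 0 →
      u ∈ Metric.closedBall (0 : EuclideanSpace ℝ (Fin n)) (R + √n * δ) := by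
    intro u hu hne
    have hT : ‖WithLp.toLp 2 t‖ ≤ R := by
      refine le_trans (le_of_eq ?_) hz
      rw [EuclideanSpace.norm_eq]
      congr 1
      refine Finset.sum_congr rfl fun j _ => ?_
      rw [ht3, Real.norm_eq_abs]
    have hd : ‖u - WithLp.toLp 2 t‖ ≤ √n * δ := by
      refine euclideanSpace_norm_le_of_abs_le hδ.le fun j => ?_
      have h1 := norm_lt_of_tentProd_ne_zero hδ hne j
      have h2 := hu j
      simp only [ha] at h2
      have h3 : (z - torusMk u) j = ((t j - u j : ℝ) : UnitAddCircle) := by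
        rw [Pi.sub_apply, ← ht2 j, torusMk, AddCircle.coe_sub]
      have h4 : |t j - u j| ≤ 1 / 2 := abs_le.2 ⟨by linarith [h2.2], by linarith [h2.1]⟩
      rw [h3, (AddCircle.norm_coe_eq_abs_iff 1 one_ne_zero).2 (by simpa using h4)] at h1
      rw [PiLp.sub_apply, abs_sub_comm]
      exact h1.le
    rw [mem_closedBall_zero_iff]
    calc ‖u‖ = ‖WithLp.toLp 2 t + (u - WithLp.toLp 2 t)‖ := by rw [add_sub_cancel]
      _ ≤ _ := (norm_add_le _ _).trans (add_le_add hT hd)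
  rw [← integral_indicator (measurableSet_unitCube a), ← integral_indicator hB]
  have hi : IntegrableOn (fun u => tentProd δ (z - torusMk u))
      (Metric.closedBall (0 : EuclideanSpace ℝ (Fin n)) (R + √n * δ)) :=
    (continuous_tentProd_sub δ z).continuousOn.integrableOn_compact (isCompact_closedBall 0 _)
  refine integral_mono_of_nonneg (Filter.Eventually.of_forall fun u => ?_)
    (hi.integrable_indicator hB) (Filter.Eventually.of_forall fun u => ?_)
  · exact Set.indicator_nonneg (fun _ _ => tentProd_nonneg hδ _) u
  · by_cases hu : u ∈ unitCube a
    · simp only [Set.indicator_of_mem hu]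
      by_cases h0 : tentProd δ (z - torusMk u) = 0
      · rw [h0]; exact Set.indicator_nonneg (fun _ _ => tentProd_nonneg hδ _) u
      · rw [Set.indicator_of_mem (hsupp u hu h0)]
    · simp only [Set.indicator_of_notMem hu]
      exact Set.indicator_nonneg (fun _ _ => tentProd_nonneg hδ _) u

/-- A ball of radius less than `1/2` embeds in a unit cube, so that smoothing it gives at most the
integral of the tent function over that cube. -/
theorem smoothedBall_le_one {n : ℕ} {δ R : ℝ} (hδ : 0 < δ) (hδ' : δ ≤ 1 / 2) (hR : R < 1 / 2)
    (z : UnitAddTorus (Fin n)) : smoothedBall δ R z ≤ 1 := by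
  set a : Fin n → ℝ := fun _ => -(1 / 2) with ha
  rw [← setIntegral_unitCube_tentProd hδ hδ' z a, smoothedBall]
  have hi : IntegrableOn (fun u => tentProd δ (z - torusMk u)) (unitCube a) := by
    by_contra h
    have := setIntegral_unitCube_tentProd hδ hδ' z a
    rw [integral_undef h] at this
    exact zero_ne_one this
  refine setIntegral_mono_set hi (Filter.Eventually.of_forall fun u => tentProd_nonneg hδ _)
    (LE.le.eventuallyLE fun u hu j => ?_)
  rw [mem_closedBall_zero_iff] at hu
  have h1 : |u j| ≤ ‖u‖ := PiLp.norm_apply_le u j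
  have h2 := abs_lt.1 (h1.trans_lt (hu.trans_lt hR))
  simp only [ha]
  exact ⟨h2.1, by linarith [h2.2]⟩

/-- The ball of radius `R - √n δ`, smoothed at scale `δ`, vanishes outside the torus ball of
radius `R`. -/
theorem smoothedBall_eq_zero {n : ℕ} {δ R : ℝ} (hδ : 0 < δ) {z : UnitAddTorus (Fin n)}
    (hz : R < √(∑ j, ‖z j‖ ^ 2)) : smoothedBall δ (R - √n * δ) z = 0 := by
  refine setIntegral_eq_zero_of_forall_eq_zero fun u hu => ?_
  by_contra hne
  rw [mem_closedBall_zero_iff] at hu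
  refine absurd hz (not_lt.2 ?_)
  have hD' : ‖WithLp.toLp 2 (fun j => max 0 (‖z j‖ - |u j|))‖ ≤ √n * δ := by
    refine euclideanSpace_norm_le_of_abs_le hδ.le fun j => ?_
    have h1 := norm_lt_of_tentProd_ne_zero hδ hne j
    have h2 : ‖z j‖ ≤ ‖(z - torusMk u) j‖ + ‖(u j : UnitAddCircle)‖ := by
      have : z j = (z - torusMk u) j + (u j : UnitAddCircle) := by
        rw [Pi.sub_apply, torusMk, sub_add_cancel]
      calc ‖z j‖ = ‖(z - torusMk u) j + (u j : UnitAddCircle)‖ := by rw [← this]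
        _ ≤ _ := norm_add_le _ _
    have h3 := norm_coe_unitAddCircle_le (u j)
    simp only
    rw [abs_of_nonneg (le_max_left _ _)]
    exact max_le hδ.le (by linarith)
  have hU : ‖WithLp.toLp 2 (fun j => |u j|)‖ = ‖u‖ := by
    simp [EuclideanSpace.norm_eq]
  calc √(∑ j, ‖z j‖ ^ 2)
      ≤ ‖WithLp.toLp 2 (fun j => |u j|) + WithLp.toLp 2 (fun j => max 0 (‖z j‖ - |u j|))‖ := by
        rw [EuclideanSpace.norm_eq]
        gcongr with j
        simp only [PiLp.add_apply]
        refine le_trans ?_ (le_abs_self _)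
        linarith [le_max_right 0 (‖z j‖ - |u j|)]
    _ ≤ ‖u‖ + √n * δ := (norm_add_le _ _).trans (add_le_add hU.le hD')
    _ ≤ R := by linarith

/-! ### Discrepancy and Fourier coefficients -/

theorem mFourier_add_apply {n : ℕ} (v : Fin n → ℤ) (x y : UnitAddTorus (Fin n)) :
    UnitAddTorus.mFourier v (x + y) = UnitAddTorus.mFourier v x * UnitAddTorus.mFourier v y := by
  simp only [UnitAddTorus.mFourier, ContinuousMap.coe_mk, Pi.add_apply, fourier_apply, smul_add,
    AddCircle.toCircle_add, Circle.coe_mul, Finset.prod_mul_distrib]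

theorem norm_mFourier_apply {n : ℕ} (v : Fin n → ℤ) (x : UnitAddTorus (Fin n)) :
    ‖UnitAddTorus.mFourier v x‖ = 1 := by
  simp only [UnitAddTorus.mFourier, ContinuousMap.coe_mk, fourier_apply, norm_prod,
    Circle.norm_coe, Finset.prod_const_one]

/-- An integer vector, as a point of Euclidean space. -/
def intVec {n : ℕ} (v : Fin n → ℤ) : EuclideanSpace ℝ (Fin n) := WithLp.toLp 2 fun j => (v j : ℝ)

theorem mFourier_neg_torusMk {n : ℕ} (v : Fin n → ℤ) (u : EuclideanSpace ℝ (Fin n)) :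
    UnitAddTorus.mFourier v (-torusMk u) =
      Complex.exp (-(2 * Real.pi * Complex.I * (inner ℝ u (intVec v) : ℝ))) := by
  have h : ∀ j, fourier (v j) ((-torusMk u) j) =
      Complex.exp (-(2 * Real.pi * Complex.I * ((v j : ℝ) * u j : ℝ))) := by
    intro j
    rw [Pi.neg_apply, torusMk, ← AddCircle.coe_neg, fourier_coe_apply]
    congr 1
    push_cast
    ring
  simp only [UnitAddTorus.mFourier, ContinuousMap.coe_mk, h]
  rw [← Complex.exp_sum]
  congr 1
  rw [Finset.sum_neg_distrib, ← Finset.mul_sum]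
  congr 2
  rw [PiLp.inner_apply]
  push_cast
  refine Finset.sum_congr rfl fun j _ => ?_
  simp [intVec]

/-- The Fourier transform at `v` of the indicator function of the ball of radius `R`. -/
def ballTransform {n : ℕ} (R : ℝ) (v : Fin n → ℤ) : ℂ :=
  ∫ u in Metric.closedBall (0 : EuclideanSpace ℝ (Fin n)) R,
    Complex.exp (-(2 * Real.pi * Complex.I * (inner ℝ u (intVec v) : ℝ)))

theorem ballTransform_zero {n : ℕ} (R : ℝ) : ballTransform R (0 : Fin n → ℤ) =
    (volume.real (Metric.closedBall (0 : EuclideanSpace ℝ (Fin n)) R) : ℂ) := by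
  have : intVec (0 : Fin n → ℤ) = 0 := by ext j; simp [intVec]
  simp [ballTransform, this]

section

variable {n : ℕ} (ν : Measure (UnitAddTorus (Fin n))) [IsProbabilityMeasure ν]

theorem integrable_tentProd_prod (δ R : ℝ) (y : UnitAddTorus (Fin n)) :
    Integrable (fun q : UnitAddTorus (Fin n) × EuclideanSpace ℝ (Fin n) =>
      tentProd δ (q.1 - y - torusMk q.2))
      (ν.prod (volume.restrict (Metric.closedBall (0 : EuclideanSpace ℝ (Fin n)) R))) := by
  have : IsFiniteMeasure
      (volume.restrict (Metric.closedBall (0 : EuclideanSpace ℝ (Fin n)) R)) :=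
    isFiniteMeasure_restrict.2 (isCompact_closedBall 0 R).measure_lt_top.ne
  have hc : Continuous fun q : UnitAddTorus (Fin n) × EuclideanSpace ℝ (Fin n) =>
      tentProd δ (q.1 - y - torusMk q.2) :=
    (continuous_tentProd δ).comp ((continuous_fst.sub continuous_const).sub
      (continuous_torusMk.comp continuous_snd))
  obtain ⟨M, hM⟩ := isCompact_univ.exists_bound_of_continuousOn
    (continuous_tentProd (n := n) δ).continuousOn
  exact Integrable.of_bound hc.aestronglyMeasurable M
    (Filter.Eventually.of_forall fun q => hM _ (Set.mem_univ _))

theorem integrable_smoothedBall (δ R : ℝ) (y : UnitAddTorus (Fin n)) :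
    Integrable (fun x => smoothedBall δ R (x - y)) ν :=
  (integrable_tentProd_prod ν δ R y).integral_prod_left

/-- The integral of a translated smoothed ball, as a sum over frequencies. -/
theorem hasSum_integral_smoothedBall {δ : ℝ} (hδ : 0 < δ) (hδ' : δ ≤ 1 / 2) (R : ℝ)
    (y : UnitAddTorus (Fin n)) :
    HasSum (fun v => (tentProdCoeff δ v : ℂ) * (ballTransform R v *
        UnitAddTorus.mFourier v (-y) * ∫ x, UnitAddTorus.mFourier v x ∂ν))
      ((∫ x, smoothedBall δ R (x - y) ∂ν : ℝ) : ℂ) := by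
  set B := Metric.closedBall (0 : EuclideanSpace ℝ (Fin n)) R with hB
  have hfin : IsFiniteMeasure (volume.restrict B) :=
    isFiniteMeasure_restrict.2 (isCompact_closedBall 0 R).measure_lt_top.ne
  set π := ν.prod (volume.restrict B) with hπ
  set F : (Fin n → ℤ) → UnitAddTorus (Fin n) × EuclideanSpace ℝ (Fin n) → ℂ := fun v q =>
    (tentProdCoeff δ v : ℂ) * UnitAddTorus.mFourier v (q.1 - y - torusMk q.2) with hF
  have hFn : ∀ v q, ‖F v q‖ = tentProdCoeff δ v := fun v q => by
    rw [hF, norm_mul, norm_mFourier_apply, mul_one, Complex.norm_real,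
      Real.norm_of_nonneg (tentProdCoeff_nonneg δ v)]
  have hFc : ∀ v, Continuous (F v) := fun v =>
    continuous_const.mul ((map_continuous (UnitAddTorus.mFourier v)).comp
      ((continuous_fst.sub continuous_const).sub (continuous_torusMk.comp continuous_snd)))
  have hFi : ∀ v, Integrable (F v) π := fun v =>
    Integrable.of_bound (hFc v).aestronglyMeasurable _
      (Filter.Eventually.of_forall fun q => (hFn v q).le)
  have hsum : Summable fun v => ∫ q, ‖F v q‖ ∂π := by
    simp only [hFn, integral_const, smul_eq_mul]
    exact (summable_tentProdCoeff n hδ).mul_left _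
  have h := hasSum_integral_of_summable_integral_norm hFi hsum
  have hval : ∫ q, ∑' v, F v q ∂π = ((∫ x, smoothedBall δ R (x - y) ∂ν : ℝ) : ℂ) := by
    have h1 : ∀ q, ∑' v, F v q = (tentProd δ (q.1 - y - torusMk q.2) : ℂ) := fun q =>
      (hasSum_tentProd hδ hδ' _).tsum_eq
    simp only [h1]
    rw [integral_complex_ofReal, hπ, integral_prod _ (integrable_tentProd_prod ν δ R y)]
    rfl
  rw [hval] at h
  have hterm : ∀ v, ∫ q, F v q ∂π = (tentProdCoeff δ v : ℂ) * (ballTransform R v *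
      UnitAddTorus.mFourier v (-y) * ∫ x, UnitAddTorus.mFourier v x ∂ν) := by
    intro v
    have h2 : ∀ q : UnitAddTorus (Fin n) × EuclideanSpace ℝ (Fin n), F v q =
        (tentProdCoeff δ v * UnitAddTorus.mFourier v (-y)) * (UnitAddTorus.mFourier v q.1 *
          UnitAddTorus.mFourier v (-torusMk q.2)) := by
      intro q
      simp only [hF, sub_eq_add_neg]
      simp only [mFourier_add_apply]
      ring
    simp only [h2]
    rw [integral_const_mul, hπ, integral_prod_mul (fun x => UnitAddTorus.mFourier v x)
      (fun u => UnitAddTorus.mFourier v (-torusMk u))]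
    simp only [mFourier_neg_torusMk, ballTransform]
    ring
  simpa only [hterm] using h

/-- The error made in integrating a smoothed ball against `ν` instead of Lebesgue measure is
controlled by the nonzero frequencies. -/
theorem abs_integral_smoothedBall_sub_le {δ : ℝ} (hδ : 0 < δ) (hδ' : δ ≤ 1 / 2) (R : ℝ)
    (y : UnitAddTorus (Fin n)) {e : (Fin n → ℤ) → ℝ} {E : ℝ} (he : HasSum e E) (he0 : 0 ≤ e 0)
    (hle : ∀ v, v ≠ 0 → tentProdCoeff δ v * (‖ballTransform R v‖ *
      ‖∫ x, UnitAddTorus.mFourier v x ∂ν‖) ≤ e v) :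
    |∫ x, smoothedBall δ R (x - y) ∂ν -
      volume.real (Metric.closedBall (0 : EuclideanSpace ℝ (Fin n)) R)| ≤ E := by
  classical
  have h := hasSum_integral_smoothedBall ν hδ hδ' R y
  set a : (Fin n → ℤ) → ℂ := fun v => (tentProdCoeff δ v : ℂ) * (ballTransform R v *
        UnitAddTorus.mFourier v (-y) * ∫ x, UnitAddTorus.mFourier v x ∂ν) with ha
  have ha0 : a 0 = (volume.real (Metric.closedBall (0 : EuclideanSpace ℝ (Fin n)) R) : ℂ) := by
    simp only [ha, tentProdCoeff_zero, ballTransform_zero, UnitAddTorus.mFourier_zero]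
    simp
  have h1 := h.sub (hasSum_ite_eq (0 : Fin n → ℤ) (a 0))
  have h2 := tsum_of_norm_bounded (f := fun v => a v - if v = 0 then a 0 else 0) he (fun v => by
    by_cases hv : v = 0
    · simpa [hv] using he0
    · rw [if_neg hv, sub_zero]
      refine le_trans (le_of_eq ?_) (hle v hv)
      rw [ha, norm_mul, norm_mul, norm_mul, norm_mFourier_apply, mul_one, Complex.norm_real,
        Real.norm_of_nonneg (tentProdCoeff_nonneg δ v)])
  rw [h1.tsum_eq, ha0, ← Complex.ofReal_sub, Complex.norm_real] at h2
  exact h2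

theorem measurableSet_torusBall (y : UnitAddTorus (Fin n)) (R : ℝ) :
    MeasurableSet (torusBall y R) :=
  (isClosed_le (by fun_prop) continuous_const).measurableSet

theorem measureReal_torusBall_le {δ : ℝ} (hδ : 0 < δ) (hδ' : δ ≤ 1 / 2) (R : ℝ)
    (y : UnitAddTorus (Fin n)) :
    ν.real (torusBall y R) ≤ ∫ x, smoothedBall δ (R + √n * δ) (x - y) ∂ν := by
  rw [← integral_indicator_one (measurableSet_torusBall y R)]
  refine integral_mono ((integrable_const 1).indicator (measurableSet_torusBall y R))
    (integrable_smoothedBall ν δ _ y) fun x => ?_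
  by_cases hx : x ∈ torusBall y R
  · rw [Set.indicator_of_mem hx]
    exact one_le_smoothedBall hδ hδ' hx
  · rw [Set.indicator_of_notMem hx]
    exact smoothedBall_nonneg hδ _ _

theorem le_measureReal_torusBall {δ R : ℝ} (hδ : 0 < δ) (hδ' : δ ≤ 1 / 2) (hR : R < 1 / 2)
    (y : UnitAddTorus (Fin n)) :
    ∫ x, smoothedBall δ (R - √n * δ) (x - y) ∂ν ≤ ν.real (torusBall y R) := by
  rw [← integral_indicator_one (measurableSet_torusBall y R)]
  refine integral_mono (integrable_smoothedBall ν δ _ y)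
    ((integrable_const 1).indicator (measurableSet_torusBall y R)) fun x => ?_
  by_cases hx : x ∈ torusBall y R
  · rw [Set.indicator_of_mem hx]
    exact smoothedBall_le_one hδ hδ' (by have : 0 ≤ √n * δ := by positivity
                                         linarith) _
  · rw [Set.indicator_of_notMem hx]
    exact (smoothedBall_eq_zero hδ (not_le.1 hx)).le

end

theorem integral_mFourier_volume {n : ℕ} {v : Fin n → ℤ} (hv : v ≠ 0) :
    ∫ x : UnitAddTorus (Fin n), UnitAddTorus.mFourier v x = 0 := by
  simp only [UnitAddTorus.mFourier, ContinuousMap.coe_mk]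
  rw [integral_fintype_prod_volume_eq_prod (fun j (s : UnitAddCircle) => fourier (v j) s)]
  obtain ⟨j, hj⟩ := Function.ne_iff.1 hv
  refine Finset.prod_eq_zero (Finset.mem_univ j) ?_
  exact integral_eq_zero_of_add_right_eq_neg (fourier_add_half_inv_index hj one_pos)

instance isProbabilityMeasure_volume_unitAddTorus (n : ℕ) :
    IsProbabilityMeasure (volume : Measure (UnitAddTorus (Fin n))) :=
  ⟨by rw [volume_pi, ← Set.pi_univ, Measure.pi_pi]; simp [AddCircle.measure_univ]⟩

/-- For `R < 0` the ball is empty, hence the maximum with `0`. -/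
theorem measureReal_closedBall_eq {n : ℕ} (hn : n ≠ 0) (R : ℝ) :
    volume.real (Metric.closedBall (0 : EuclideanSpace ℝ (Fin n)) R) =
      max R 0 ^ n * volume.real (Metric.closedBall (0 : EuclideanSpace ℝ (Fin n)) 1) := by
  rcases le_or_gt 0 R with h | h
  · rw [Measure.addHaar_real_closedBall' _ _ h, max_eq_left h, finrank_euclideanSpace_fin]
  · rw [Metric.closedBall_eq_empty.2 h, max_eq_right h.le, zero_pow hn, zero_mul,
      measureReal_empty]

theorem pow_sub_pow_le {a b M : ℝ} (n : ℕ) (hb : 0 ≤ b) (hab : b ≤ a) (haM : a ≤ M) :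
    a ^ n - b ^ n ≤ n * M ^ (n - 1) * (a - b) := by
  have ha : 0 ≤ a := hb.trans hab
  have hM : 0 ≤ M := ha.trans haM
  rw [← (Commute.all a b).geom_sum₂_mul]
  refine mul_le_mul_of_nonneg_right ?_ (by linarith)
  calc ∑ i ∈ Finset.range n, a ^ i * b ^ (n - 1 - i)
      ≤ ∑ i ∈ Finset.range n, M ^ (n - 1) := by
        refine Finset.sum_le_sum fun i hi => ?_
        have : n - 1 = i + (n - 1 - i) := by have := Finset.mem_range.1 hi; omega
        calc a ^ i * b ^ (n - 1 - i) ≤ M ^ i * M ^ (n - 1 - i) := by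
              gcongr
              linarith
          _ = M ^ (n - 1) := by rw [← pow_add, ← this]
    _ = n * M ^ (n - 1) := by simp

/-- Discrepancy bound for a probability measure, in terms of its Fourier coefficients. -/
theorem exists_ballDiscrepancy_le {n : ℕ} (hn : n ≠ 0) :
    ∃ A, 0 < A ∧ ∀ (ν : Measure (UnitAddTorus (Fin n))) [IsProbabilityMeasure ν] (δ : ℝ),
      0 < δ → δ ≤ 1 / 2 → ∀ (e : (Fin n → ℤ) → ℝ) (E : ℝ), HasSum e E → (∀ v, 0 ≤ e v) →
      (∀ R ≤ 1 / 2 + √n, ∀ v, v ≠ 0 → tentProdCoeff δ v * (‖ballTransform R v‖ *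
        ‖∫ x, UnitAddTorus.mFourier v x ∂ν‖) ≤ e v) →
      ballDiscrepancy ν ≤ A * δ + E := by
  set κ := volume.real (Metric.closedBall (0 : EuclideanSpace ℝ (Fin n)) 1) with hκ
  have hκ0 : 0 ≤ κ := measureReal_nonneg
  set M : ℝ := 1 / 2 + √n with hM
  have hM0 : 0 < M := by positivity
  refine ⟨κ * (n * M ^ (n - 1) * (2 * √n)) + 1, by positivity,
    fun ν _ δ hδ hδ' e E he he0 hle => ?_⟩
  have : Nonempty (Set.Ioo (0 : ℝ) (1 / 2)) := ⟨⟨1 / 4, by norm_num⟩⟩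
  refine ciSup_le fun ⟨y, R, hR0, hR⟩ => ?_
  simp only
  set ρ := √n * δ with hρ
  have hρ0 : 0 ≤ ρ := by positivity
  have hR1 : R + ρ ≤ M := by
    have : √n * δ ≤ √n * 1 := by gcongr; linarith
    linarith
  have hE : 0 ≤ E := he.nonneg he0
  have b1 := measureReal_torusBall_le ν hδ hδ' R y
  have b2 := le_measureReal_torusBall ν hδ hδ' hR y
  have b3 := measureReal_torusBall_le volume hδ hδ' R y
  have b4 := le_measureReal_torusBall volume hδ hδ' hR y
  have c1 := abs_le.1 (abs_integral_smoothedBall_sub_le ν hδ hδ' (R + ρ) y he (he0 0)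
    (hle _ hR1))
  have c2 := abs_le.1 (abs_integral_smoothedBall_sub_le ν hδ hδ' (R - ρ) y he (he0 0)
    (hle _ (by linarith)))
  -- the nonzero frequencies of Lebesgue measure vanish, so the error term is zero
  have hvol : ∀ R' : ℝ, |(∫ x, smoothedBall δ R' (x - y)) -
      volume.real (Metric.closedBall (0 : EuclideanSpace ℝ (Fin n)) R')| ≤ 0 := fun R' =>
    abs_integral_smoothedBall_sub_le volume hδ hδ' R' y hasSum_zero le_rfl fun v hv => by
      rw [integral_mFourier_volume hv]; simp
  have c3 := abs_le.1 (hvol (R + ρ))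
  have c4 := abs_le.1 (hvol (R - ρ))
  have d : volume.real (Metric.closedBall (0 : EuclideanSpace ℝ (Fin n)) (R + ρ)) -
      volume.real (Metric.closedBall (0 : EuclideanSpace ℝ (Fin n)) (R - ρ)) ≤
      κ * (n * M ^ (n - 1) * (2 * √n)) * δ := by
    rw [measureReal_closedBall_eq hn, measureReal_closedBall_eq hn (R - ρ),
      max_eq_left (by linarith : 0 ≤ R + ρ), ← sub_mul, mul_comm, mul_assoc κ]
    refine mul_le_mul_of_nonneg_left ?_ hκ0
    have h1 := pow_sub_pow_le n (le_max_right (R - ρ) 0)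
      (max_le (by linarith) (by linarith) : max (R - ρ) 0 ≤ R + ρ) hR1
    refine h1.trans ?_
    rw [mul_assoc _ (2 * √n)]
    refine mul_le_mul_of_nonneg_left ?_ (by positivity)
    have : R - ρ ≤ max (R - ρ) 0 := le_max_left _ _
    have e2 : 2 * √n * δ = 2 * ρ := by rw [hρ]; ring
    linarith
  rw [abs_le]
  constructor <;> nlinarith

/-! ### Weyl sums -/

/-- The Fourier coefficients of `μ_G` are the normalized Weyl sums. -/
theorem PolynomialSystem.integral_mFourier_measure {p m n : ℕ} [Fact p.Prime]
    (G : PolynomialSystem p m n) (v : Fin n → ℤ) :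
    ∫ x, UnitAddTorus.mFourier v x ∂G.measure = ((p : ℂ) ^ m)⁻¹ * G.weylSum v := by
  have hpt : ∀ x, UnitAddTorus.mFourier v (G.point x) =
      ZMod.stdAddChar (∑ j : Fin n, (v j : ZMod p) * MvPolynomial.eval x (G j)) := by
    intro x
    have hsum : ZMod.stdAddChar (∑ j : Fin n, (v j : ZMod p) * MvPolynomial.eval x (G j)) =
        ∏ j : Fin n, ZMod.stdAddChar ((v j : ZMod p) * MvPolynomial.eval x (G j)) :=
      map_sum (ZMod.stdAddChar (N := p)).toAddMonoidHom _ _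
    rw [hsum]
    simp only [UnitAddTorus.mFourier, ContinuousMap.coe_mk]
    refine Finset.prod_congr rfl fun j _ => ?_
    rw [fourier_apply, point, ← map_zsmul, zsmul_eq_mul]
    rfl
  have hint : ∀ x ∈ Finset.univ, Integrable (fun y => UnitAddTorus.mFourier v y)
      (Measure.dirac (G.point x)) := fun x _ =>
    integrable_dirac (by simp)
  rw [measure, integral_smul_measure, integral_finsetSum_measure hint]
  simp only [integral_dirac, hpt, weylSum]
  rw [ENNReal.toReal_inv, ENNReal.toReal_pow, ENNReal.toReal_natCast, Complex.real_smul]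
  push_cast
  rfl

/-- The product over the coordinates of `dampedWeight`. -/
def dampedWeightProd {n : ℕ} (β δ : ℝ) (v : Fin n → ℤ) : ℝ := ∏ j, dampedWeight β δ (v j)

theorem dampedWeightProd_nonneg {n : ℕ} (β δ : ℝ) (v : Fin n → ℤ) :
    0 ≤ dampedWeightProd β δ v := Finset.prod_nonneg fun _ _ => dampedWeight_nonneg β _

theorem hasSum_dampedWeightProd (n : ℕ) {β δ : ℝ} (hβ0 : 0 ≤ β) (hβ1 : β < 1) (hδ : 0 < δ) :
    HasSum (dampedWeightProd (n := n) β δ) ((∑' k, dampedWeight β δ k) ^ n) := by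
  have hs := (summable_dampedWeight_and_tsum_le hβ0 hβ1 hδ).1
  have h := (hasSum_pi_prod (fun _ : Fin n => hs.hasSum) fun _ => hs.norm).1
  rw [Finset.prod_const, Finset.card_univ, Fintype.card_fin] at h
  exact h

theorem tsum_dampedWeight_pow_le {n : ℕ} {β δ : ℝ} (hβ0 : 0 ≤ β) (hβ1 : β < 1) (hδ : 0 < δ) :
    (∑' k, dampedWeight β δ k) ^ n ≤
      (2 * (2 / (1 - β))) ^ n * (1 + δ ^ (n * (β - 1))) := by
  have h1 := (summable_dampedWeight_and_tsum_le hβ0 hβ1 hδ).2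
  have h0 : 0 ≤ ∑' k, dampedWeight β δ k := tsum_nonneg fun k => dampedWeight_nonneg β k
  have hb : 0 < 1 - β := by linarith
  set x := δ ^ (β - 1) with hx
  have hx0 : 0 ≤ x := by positivity
  have hxn : δ ^ (n * (β - 1)) = x ^ n := by
    rw [hx, mul_comm, Real.rpow_mul_natCast hδ.le]
  have h2 : (1 + x) ^ n ≤ 2 ^ n * (1 + x ^ n) := by
    rcases le_total x 1 with h | h
    · calc (1 + x) ^ n ≤ 2 ^ n := by gcongr; linarith
        _ ≤ 2 ^ n * (1 + x ^ n) :=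
          le_mul_of_one_le_right (by positivity) (by linarith [pow_nonneg hx0 n])
    · calc (1 + x) ^ n ≤ (2 * x) ^ n := by gcongr; linarith
        _ = 2 ^ n * x ^ n := mul_pow _ _ _
        _ ≤ 2 ^ n * (1 + x ^ n) := by gcongr; linarith
  calc (∑' k, dampedWeight β δ k) ^ n ≤ (2 / (1 - β) * (1 + x)) ^ n := by gcongr
    _ = (2 / (1 - β)) ^ n * (1 + x) ^ n := mul_pow _ _ _
    _ ≤ (2 / (1 - β)) ^ n * (2 ^ n * (1 + x ^ n)) := by gcongr
    _ = _ := by rw [hxn, mul_pow]; ring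

/-- Since `‖v‖ ≥ max(1, |v_j|)` for every `j`, the power `‖v‖^{-nβ}` is at most a product of
powers of the coordinates, so that sums over `ℤⁿ` factorize. -/
theorem norm_intVec_rpow_le {n : ℕ} {β : ℝ} (hβ0 : 0 ≤ β) {v : Fin n → ℤ} (hv : v ≠ 0) :
    ‖intVec v‖ ^ (-(n * β)) ≤ ∏ j, max 1 |(v j : ℝ)| ^ (-β) := by
  have hj : ∀ j, |(v j : ℝ)| ≤ ‖intVec v‖ := fun j => PiLp.norm_apply_le (intVec v) j
  have h1 : 1 ≤ ‖intVec v‖ := by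
    obtain ⟨i, hi⟩ := Function.ne_iff.1 hv
    refine le_trans ?_ (hj i)
    exact_mod_cast Int.one_le_abs hi
  have h0 : 0 < ‖intVec v‖ := by linarith
  calc ‖intVec v‖ ^ (-(n * β)) = ∏ _j : Fin n, ‖intVec v‖ ^ (-β) := by
        rw [Finset.prod_const, Finset.card_univ, Fintype.card_fin, ← Real.rpow_mul_natCast h0.le]
        congr 1
        ring
    _ ≤ _ := by
        refine Finset.prod_le_prod (fun j _ => by positivity) fun j _ => ?_
        exact Real.rpow_le_rpow_of_nonpos (by positivity) (max_le h1 (hj j)) (by linarith)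

theorem tentProdCoeff_le {n : ℕ} {δ : ℝ} (hδ : 0 < δ) (v : Fin n → ℤ) :
    tentProdCoeff δ v ≤ 4 ^ n * ∏ j, ((1 + δ * |(v j : ℝ)|) ^ 2)⁻¹ := by
  have : (4 : ℝ) ^ n = ∏ _j : Fin n, 4 := by simp
  rw [this, ← Finset.prod_mul_distrib]
  exact Finset.prod_le_prod (fun j _ => tentCoeff_nonneg δ _) fun j _ => tentCoeff_le hδ _

/-- The contribution to the discrepancy of a frequency `q v`, with `v ≠ 0`. -/
theorem tentProdCoeff_mul_norm_rpow_le {n : ℕ} {β δ q : ℝ} (hβ0 : 0 ≤ β) (hδ : 0 < δ)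
    (hq : 0 < q) {v w : Fin n → ℤ} (hv : v ≠ 0) (hw : ∀ j, (w j : ℝ) = q * v j) :
    tentProdCoeff δ w * ‖intVec w‖ ^ (-(n * β)) ≤
      4 ^ n * q ^ (-(n * β)) * dampedWeightProd β (q * δ) v := by
  have hn : ‖intVec w‖ = q * ‖intVec v‖ := by
    have : intVec w = q • intVec v := by ext j; simp [intVec, hw]
    rw [this, norm_smul, Real.norm_of_nonneg hq.le]
  have h1 := tentProdCoeff_le hδ w
  have h2 : ∀ j, δ * |(w j : ℝ)| = q * δ * |(v j : ℝ)| := fun j => by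
    rw [hw, abs_mul, abs_of_pos hq]; ring
  simp only [h2] at h1
  rw [hn, Real.mul_rpow hq.le (norm_nonneg _)]
  calc tentProdCoeff δ w * (q ^ (-(n * β)) * ‖intVec v‖ ^ (-(n * β)))
      ≤ (4 ^ n * ∏ j, ((1 + q * δ * |(v j : ℝ)|) ^ 2)⁻¹) *
        (q ^ (-(n * β)) * ∏ j, max 1 |(v j : ℝ)| ^ (-β)) := by
        gcongr
        exact norm_intVec_rpow_le hβ0 hv
    _ = _ := by
        simp only [dampedWeightProd, dampedWeight, Finset.prod_mul_distrib]
        ring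

open Classical in
/-- The weight of the frequencies `v = p w` in `p ℤⁿ`, which is `dampedWeightProd β δ w`. -/
def multiplesWeight {n : ℕ} (p : ℕ) (β δ : ℝ) (v : Fin n → ℤ) : ℝ :=
  if ∀ j, (p : ℤ) ∣ v j then dampedWeightProd β δ (fun j => v j / p) else 0

theorem multiplesWeight_nonneg {n : ℕ} (p : ℕ) (β δ : ℝ) (v : Fin n → ℤ) :
    0 ≤ multiplesWeight p β δ v := by
  unfold multiplesWeight
  split_ifs
  · exact dampedWeightProd_nonneg _ _ _
  · exact le_rfl

theorem hasSum_multiplesWeight (n : ℕ) {p : ℕ} (hp : p ≠ 0) {β δ : ℝ} (hβ0 : 0 ≤ β) (hβ1 : β < 1)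
    (hδ : 0 < δ) :
    HasSum (multiplesWeight (n := n) p β δ) ((∑' k, dampedWeight β δ k) ^ n) := by
  have hp' : (p : ℤ) ≠ 0 := by exact_mod_cast hp
  set g : (Fin n → ℤ) → (Fin n → ℤ) := fun w j => p * w j with hg
  have hgi : Function.Injective g := fun w w' h => by
    ext j
    exact mul_left_cancel₀ hp' (congrFun h j)
  have hcomp : multiplesWeight p β δ ∘ g = dampedWeightProd β δ := by
    ext w
    have : ∀ j, (p : ℤ) ∣ g w j := fun j => dvd_mul_right _ _
    rw [Function.comp_apply, multiplesWeight, if_pos this]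
    congr 1
    ext j
    exact Int.mul_ediv_cancel_left _ hp'
  refine (hgi.hasSum_iff fun v hv => ?_).1 (hcomp ▸ hasSum_dampedWeightProd n hβ0 hβ1 hδ)
  refine if_neg fun h => hv ?_
  choose w hw using h
  exact ⟨w, funext fun j => (hw j).symm⟩

end

theorem corollary1p7 (n : ℕ) (hn : 2 ≤ n) (η : ℝ) (hη : 0 ≤ η) (C : ℝ) :
    ∃ C' : ℝ, 0 < C' ∧ ∀ (p m : ℕ) [Fact p.Prime] (G : PolynomialSystem p m n),
      G.IsOfTypeWith η C →
        ballDiscrepancy G.measure ≤ C' * (p : ℝ) ^ (-(2 * min η (n : ℝ)) / ((n : ℝ) + 1)) := by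
  have hn2 : (2 : ℝ) ≤ n := by exact_mod_cast hn
  obtain ⟨A, hA0, hA⟩ := exists_ballDiscrepancy_le (n := n) (by omega)
  obtain ⟨K, hK0, hK⟩ := exists_closedBall_fourier_bound hn (1 / 2 + √n)
  set β : ℝ := ((n : ℝ) + 1) / (2 * n) with hβ
  set s : ℝ := ((n : ℝ) - 1) / 2 with hs
  set t : ℝ := ((n : ℝ) + 1) / 2 with ht
  have hβ0 : 0 ≤ β := by positivity
  have hβ1 : β < 1 := by rw [hβ, div_lt_one (by positivity)]; linarith
  have hnβ : (n : ℝ) * β = t := by rw [hβ, ht]; field_simp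
  have hnβ1 : (n : ℝ) * (β - 1) = -s := by rw [mul_sub, hnβ, ht, hs]; ring
  have hs0 : 0 ≤ s := by rw [hs]; linarith
  have hst : s + 1 = t := by rw [hs, ht]; ring
  set S : ℝ := (2 * (2 / (1 - β))) ^ n with hS
  have hb : 0 < 1 - β := by linarith
  have hS0 : 0 ≤ S := by positivity
  set D : ℝ := K * 4 ^ n * |C| with hD
  have hD0 : 0 ≤ D := by positivity
  set μ : ℝ := min η n with hμ
  set τ : ℝ := μ / t with hτ
  have hμ0 : 0 ≤ μ := le_min hη (by positivity)
  have ht0 : 0 < t := by positivity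
  have hτ0 : 0 ≤ τ := by positivity
  have hτt : τ * t = μ := div_mul_cancel₀ _ ht0.ne'
  -- this amounts to `4 n ≤ (n + 1)²`
  have hτt' : τ ≤ t := by
    have h1 : μ ≤ n := min_le_right _ _
    rw [hτ, div_le_iff₀ ht0, ht]
    nlinarith [sq_nonneg ((n : ℝ) - 1)]
  refine ⟨A + D * (S * (2 * 2 ^ s) + S * (1 + 2 ^ s)), by positivity, fun p m _ G hG => ?_⟩
  have hexp : -(2 * min η (n : ℝ)) / ((n : ℝ) + 1) = -τ := by
    rw [hτ, ← hμ, ht]; field_simp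
  rw [hexp]
  have hpp : p.Prime := Fact.out
  have hp1 : (1 : ℝ) ≤ p := by exact_mod_cast hpp.one_lt.le
  have hp0 : (0 : ℝ) < p := by linarith
  set δ : ℝ := (p : ℝ) ^ (-τ) / 2 with hδ
  have hδ0 : 0 < δ := by positivity
  have hpτ : (p : ℝ) ^ (-τ) ≤ 1 := Real.rpow_le_one_of_one_le_of_nonpos hp1 (by linarith)
  have hδ' : δ ≤ 1 / 2 := by rw [hδ]; linarith
  have hδs : δ ^ (-s) = 2 ^ s * (p : ℝ) ^ (τ * s) := by
    rw [hδ, Real.div_rpow (by positivity) zero_le_two, ← Real.rpow_mul hp0.le,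
      Real.rpow_neg zero_le_two, div_inv_eq_mul, mul_comm]
    congr 2
    ring
  have hpδ : 0 < p * δ := by positivity
  set e : (Fin n → ℤ) → ℝ := fun v => D * ((p : ℝ) ^ (-η) * dampedWeightProd β δ v +
    (p : ℝ) ^ (-t) * multiplesWeight p β (p * δ) v) with he
  have hsum := (((hasSum_dampedWeightProd n hβ0 hβ1 hδ0).mul_left ((p : ℝ) ^ (-η))).add
    ((hasSum_multiplesWeight n hpp.ne_zero hβ0 hβ1 hpδ).mul_left ((p : ℝ) ^ (-t)))).mul_left D
  have he0 : ∀ v, 0 ≤ e v := fun v => by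
    have := dampedWeightProd_nonneg β δ v
    have := multiplesWeight_nonneg p β (p * δ) v
    simp only [he]
    positivity
  have hle : ∀ R ≤ 1 / 2 + √n, ∀ v, v ≠ 0 → tentProdCoeff δ v * (‖ballTransform R v‖ *
        ‖∫ x, UnitAddTorus.mFourier v x ∂G.measure‖) ≤ e v := by
    intro R hR v hv
    have hiv : intVec v ≠ 0 := fun h => hv (by
      ext j
      have hj : (v j : ℝ) = 0 := congrArg (fun u : EuclideanSpace ℝ (Fin n) => u j) h
      exact_mod_cast hj)
    have hJ : ‖ballTransform R v‖ ≤ K * ‖intVec v‖ ^ (-(n * β)) := by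
      rw [hnβ]
      exact hK R hR _ hiv
    have hF := hG v
    rw [G.integral_mFourier_measure, norm_mul, norm_inv, norm_pow, Complex.norm_natCast,
      inv_mul_eq_div]
    have hc := tentProdCoeff_nonneg δ v
    have hw0 := dampedWeightProd_nonneg β δ v
    have hm0 := multiplesWeight_nonneg p β (p * δ) v
    simp only [he]
    by_cases hdvd : ∀ j, (p : ℤ) ∣ v j
    · rw [if_pos hdvd, mul_one] at hF
      have hF' := hF.trans (le_abs_self C)
      have hw : ∀ j, ((v j : ℤ) : ℝ) = p * ((v j / p : ℤ) : ℝ) := fun j => by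
        have := Int.mul_ediv_cancel' (hdvd j)
        exact_mod_cast this.symm
      have hne : (fun j => v j / (p : ℤ)) ≠ 0 := fun h => hv (by
        ext j
        have h1 : v j / (p : ℤ) = 0 := congrFun h j
        have h2 := Int.mul_ediv_cancel' (hdvd j)
        rw [h1, mul_zero] at h2
        exact h2.symm)
      have hmain := tentProdCoeff_mul_norm_rpow_le hβ0 hδ0 hp0 hne hw
      have hmw : multiplesWeight p β (p * δ) v =
          dampedWeightProd β (p * δ) (fun j => v j / p) := if_pos hdvd
      calc tentProdCoeff δ v * (‖ballTransform R v‖ * (‖G.weylSum v‖ / (p : ℝ) ^ m))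
          ≤ tentProdCoeff δ v * ((K * ‖intVec v‖ ^ (-(n * β))) * |C|) := by gcongr
        _ = K * |C| * (tentProdCoeff δ v * ‖intVec v‖ ^ (-(n * β))) := by ring
        _ ≤ K * |C| * (4 ^ n * (p : ℝ) ^ (-(n * β)) *
            dampedWeightProd β (p * δ) (fun j => v j / p)) := by gcongr
        _ = D * (0 + (p : ℝ) ^ (-t) * multiplesWeight p β (p * δ) v) := by
            rw [hmw, hnβ, hD]; ring
        _ ≤ _ := by gcongr; positivity
    · rw [if_neg hdvd] at hF
      have hF' : ‖G.weylSum v‖ / (p : ℝ) ^ m ≤ |C| * (p : ℝ) ^ (-η) :=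
        hF.trans (by gcongr; exact le_abs_self C)
      have hmain := tentProdCoeff_mul_norm_rpow_le hβ0 hδ0 one_pos hv (w := v) (by simp)
      rw [one_mul, Real.one_rpow, mul_one] at hmain
      calc tentProdCoeff δ v * (‖ballTransform R v‖ * (‖G.weylSum v‖ / (p : ℝ) ^ m))
          ≤ tentProdCoeff δ v * ((K * ‖intVec v‖ ^ (-(n * β))) * (|C| * (p : ℝ) ^ (-η))) := by
            gcongr
        _ = K * |C| * (p : ℝ) ^ (-η) * (tentProdCoeff δ v * ‖intVec v‖ ^ (-(n * β))) := by ring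
        _ ≤ K * |C| * (p : ℝ) ^ (-η) * (4 ^ n * dampedWeightProd β δ v) := by gcongr
        _ = D * ((p : ℝ) ^ (-η) * dampedWeightProd β δ v + 0) := by rw [hD]; ring
        _ ≤ _ := by gcongr; positivity
  refine (hA G.measure δ hδ0 hδ' e _ hsum he0 hle).trans ?_
  -- both exponents reduce to `τ (s + 1) = min η n`, which is at most `η` and at most `n`
  have h1 := tsum_dampedWeight_pow_le (n := n) hβ0 hβ1 hδ0
  have h2 := tsum_dampedWeight_pow_le (n := n) hβ0 hβ1 hpδ
  rw [hnβ1] at h1 h2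
  have hτs : τ * s = μ - τ := by rw [← hτt, ← hst]; ring
  have k1 : (p : ℝ) ^ (-η) * (1 + δ ^ (-s)) ≤ 2 * 2 ^ s * (p : ℝ) ^ (-τ) := by
    have h3 : 1 ≤ δ ^ (-s) :=
      Real.one_le_rpow_of_pos_of_le_one_of_nonpos hδ0 (by linarith) (by linarith)
    calc (p : ℝ) ^ (-η) * (1 + δ ^ (-s)) ≤ (p : ℝ) ^ (-η) * (2 * δ ^ (-s)) := by
          gcongr; linarith
      _ = 2 * 2 ^ s * (p : ℝ) ^ (-η + τ * s) := by rw [hδs, Real.rpow_add hp0]; ring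
      _ ≤ _ := by
          gcongr
          have : μ ≤ η := min_le_left _ _
          linarith
  have k2 : (p : ℝ) ^ (-t) * (1 + (p * δ) ^ (-s)) ≤ (1 + 2 ^ s) * (p : ℝ) ^ (-τ) := by
    have h3 : (p : ℝ) ^ (-t) ≤ (p : ℝ) ^ (-τ) :=
      Real.rpow_le_rpow_of_exponent_le hp1 (by linarith)
    have h4 : (p : ℝ) ^ (-t) * (p * δ) ^ (-s) ≤ 2 ^ s * (p : ℝ) ^ (-τ) := by
      calc (p : ℝ) ^ (-t) * (p * δ) ^ (-s) = 2 ^ s * (p : ℝ) ^ (-t + -s + τ * s) := by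
            rw [Real.mul_rpow hp0.le hδ0.le, hδs, Real.rpow_add hp0, Real.rpow_add hp0]; ring
        _ ≤ _ := by
            gcongr
            have h5 : μ ≤ n := min_le_right _ _
            have h6 : t + s = n := by rw [ht, hs]; ring
            linarith
    linarith
  calc A * δ + D * ((p : ℝ) ^ (-η) * (∑' k, dampedWeight β δ k) ^ n +
        (p : ℝ) ^ (-t) * (∑' k, dampedWeight β (p * δ) k) ^ n)
      ≤ A * (p : ℝ) ^ (-τ) + D * ((p : ℝ) ^ (-η) * (S * (1 + δ ^ (-s))) +
        (p : ℝ) ^ (-t) * (S * (1 + (p * δ) ^ (-s)))) := by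
        gcongr
        rw [hδ]
        linarith [Real.rpow_nonneg hp0.le (-τ)]
    _ = A * (p : ℝ) ^ (-τ) + D * (S * ((p : ℝ) ^ (-η) * (1 + δ ^ (-s))) +
        S * ((p : ℝ) ^ (-t) * (1 + (p * δ) ^ (-s)))) := by ring
    _ ≤ A * (p : ℝ) ^ (-τ) + D * (S * (2 * 2 ^ s * (p : ℝ) ^ (-τ)) +
        S * ((1 + 2 ^ s) * (p : ℝ) ^ (-τ))) := by gcongr
    _ = _ := by ring
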